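/- **Setting.** Let $d,\nu\ge 1$ be integers. Sites are $i=(l,j)\in\mathbb Z^\nu\times\mathbb Z^d$; $|\cdot|$ denotes the sup norm on vectors, $\|j\|^2=\sum_k j_k^2$ and $\langle n\rangle=\max(|n|,1)$. Distances and diameters of sets of sites are taken with respect to $|\cdot|$. *Matrices.* Let $\bar\omega\in\mathbb R^\nu$, $|\bar\omega|\le 1$, satisfy $|\bar\omega\cdot l|\ge 2\gamma_0/|l|^{\nu}$ for all $l\in\mathbb Z^\nu\setminus\{0\}$, where $\gamma_0\in(0,1)$. Let $V:\mathbb T^d\to\mathbb R$ be continuous with mean $m$, let $f:\mathbb T^\nu\times\mathbb T^d\times\mathbb R\to\mathbb R$ be $C^1$ and $u:\mathbb T^\nu\times\mathbb T^d\to\mathbb R$ continuous ($\mathbb T=\mathbb R/2\pi\mathbb Z$), and put $g(\varphi,x)=(\partial_uf)(\varphi,x,u(\varphi,x))$. For $\varepsilon\in\mathbb R$, $\lambda\in\Lambda:=[1/2,3/2]$, $\theta\in\mathbb R$ let $A(\varepsilon,\lambda,\theta)=D(\lambda,\theta)+T$ be the infinite matrix indexed by the sites, where $D$ is diagonal with entries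 $-(\lambda\bar\omega\cdot l+\theta)^2+\|j\|^2+m$ and $T$ represents, in the basis $e^{\mathrm i(l\cdot\varphi+j\cdot x)}$, multiplication by $V-m-\varepsilon g$ (so that its $((l,j),(l',j'))$ entry is the Fourier coefficient of $V(x)-m-\varepsilon g(\varphi,x)$ with index $(l-l',j-j')$). The functions $f,u$ may depend on the (fixed) values of $\varepsilon,\lambda$, but not on $\theta$. $A_{N,i}$ is the restriction of $A$ to the sites $i'$ with $|i'-i|\le N$. *Good matrices.* Fix $K_0>0$, $(d+\nu)/2<s_0\le s_1$, $\tau'\in\mathbb R$, $\delta\in(0,1)$. For a matrix $M$ indexed by a finite set $E$ of sites put $|M|_s^2=K_0\sum_{n\in E-E}[M(n)]^2\langle n\rangle^{2s}$, $[M(n)]=\max_{i-i'=n}|M_i^{i'}|$. $M$ is *$N$-good* if it is invertible and $|M^{-1}|_s\le N^{\tau'+\delta s}$ for all $s\in[s_0,s_1]$; otherwise it is *$N$-bad*. *Good sites.* Let $L_0\in\mathbb N$ with $N-2L_0\ge N/2$, and let $\mathcal Q_N$ be the set of $j\in\mathbb Z^d$ such that $\mathrm d(0,\partial(j+[-N,N]^d))<L_0$,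 where $\partial B=\{j\in B:\mathrm d(j,\mathbb Z^d\setminus B)=1\}$ for $B\subset\mathbb Z^d$. Let $\Theta\ge1$. A site $i$ is *$N$-good* for $A$ if $|A_i^i|\ge\Theta$, or if for both $M\in\{N-2L_0,N\}$ and all $i'=(l',j')$ with $|i'-i|\le M$ and $j'\notin\mathcal Q_M$ the matrix $A_{M,i'}$ is $M$-good; otherwise $i$ is *$N$-bad*. *Good parameters.* $\lambda\in\Lambda$ is *$N$-good for $A$* (with exponent $\tau$) if for both $M\in\{N,N-2L_0\}$ and all $j_0\in\mathbb Z^d\setminus\mathcal Q_M$ the set of $\theta\in\mathbb R$ for which $A_{M,(0,j_0)}(\varepsilon,\lambda,\theta)$ is $M$-bad is contained in a union of $N^{2d+\nu+3}$ intervals of length at most $N^{-\tau}$. *Non-resonance.* $\omega\in\mathbb R^\nu$ satisfies **(NR)** with constant $\gamma>0$ if, with $\tau_0=\nu(\nu+1)$, $$\Big|n+\sum_{1\le i\le j\le\nu}p_{ij}\,\omega_i\omega_j\Big|\ \ge\ \frac{\gamma}{1+|p|^{\tau_0}}\qquad\text{for all }(n,p)\in\mathbb Z\times\mathbb Z^{\nu(\nu+1)/2},\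 (n,p)\ne(0,0).$$ **Proposition (Separation properties of $N$-bad sites).** For all $d,\nu\ge1$ there is a constant $C_1=C_1(d,\nu)\ge2$ such that, for all $\gamma_0\in(0,1)$, $\Theta\ge1$, $\gamma>0$, $\chi>1$ and $\tau>\chi\nu$, there is $N_0\in\mathbb N$, depending only on $d,\nu,\gamma_0,\Theta,\gamma,\chi,\tau$, with the following property. For every integer $N\ge N_0$ and all data as above: if $\lambda\in\Lambda$ is $N$-good for $A$ and $\omega=\lambda\bar\omega$ satisfies (NR) with constant $\gamma$, then, for every $\theta\in\mathbb R$, the $N$-bad sites $(l,j)$ of $A(\varepsilon,\lambda,\theta)$ with $|l|\le N^\chi$ admit a partition $\bigcup_\alpha\Omega_\alpha$ into pairwise disjoint nonempty clusters with $$\mathrm{diam}(\Omega_\alpha)\le N^{C_1},\qquad \mathrm d(\Omega_\alpha,\Omega_\beta)>N^2\quad\text{for all }\alpha\ne\beta.$$ -/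

import Mathlib

noncomputable section

/-- Lattice sites `i = (l, j)`, with time frequencies `l` and space frequencies `j`. The norm
of a site is the sup norm `|i| = max (|l|, |j|)`. -/
abbrev Site (ν d : ℕ) : Type := (Fin ν → ℤ) × (Fin d → ℤ)

/-- `2π`-periodicity in each of the `n` variables: functions on the torus `(ℝ / 2πℤ)ⁿ`. -/
def TorusPeriodic {n : ℕ} (h : (Fin n → ℝ) → ℝ) : Prop :=
  ∀ (x : Fin n → ℝ) (k : Fin n → ℤ), h (fun a => x a + 2 * Real.pi * (k a : ℝ)) = h x

/-- The average of a function over the `d`-dimensional torus. -/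
def torusMean {d : ℕ} (V : (Fin d → ℝ) → ℝ) : ℝ :=
  ((2 * Real.pi) ^ d)⁻¹ * ∫ x in Set.Icc (0 : Fin d → ℝ) (fun _ => 2 * Real.pi), V x

/-- The Fourier coefficient of index `j` of a function `h(x)`. -/
def fourierSpace {d : ℕ} (h : (Fin d → ℝ) → ℝ) (j : Fin d → ℤ) : ℂ :=
  ((2 * (Real.pi : ℂ)) ^ d)⁻¹ *
    ∫ x in Set.Icc (0 : Fin d → ℝ) (fun _ => 2 * Real.pi),
      (h x : ℂ) * Complex.exp (-(Complex.I * ((∑ a, (j a : ℝ) * x a : ℝ) : ℂ)))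

/-- The Fourier coefficient of index `i = (l, j)` of a function `g(φ, x)`. -/
def fourierSpaceTime {ν d : ℕ} (g : (Fin ν → ℝ) → (Fin d → ℝ) → ℝ) (i : Site ν d) : ℂ :=
  ((2 * (Real.pi : ℂ)) ^ (ν + d))⁻¹ *
    ∫ p in Set.Icc (0 : (Fin ν → ℝ) × (Fin d → ℝ))
        ((fun _ => 2 * Real.pi), (fun _ => 2 * Real.pi)),
      (g p.1 p.2 : ℂ) * Complex.exp (-(Complex.I *
        ((∑ a, (i.1 a : ℝ) * p.1 a + ∑ a, (i.2 a : ℝ) * p.2 a : ℝ) : ℂ)))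

/-- The function `g(φ, x) = (∂_u f)(φ, x, u(φ, x))`. -/
def linearizedCoeff {ν d : ℕ} (f : (Fin ν → ℝ) → (Fin d → ℝ) → ℝ → ℝ)
    (u : (Fin ν → ℝ) → (Fin d → ℝ) → ℝ) : (Fin ν → ℝ) → (Fin d → ℝ) → ℝ :=
  fun φ x => deriv (fun y => f φ x y) (u φ x)

/-- The infinite matrix `A(ε, λ, θ) = D(λ, θ) + T`, in the exponential basis. The diagonal part
has entries `-(λ ω̄·l + θ)² + ‖j‖² + m`, where `m` is the mean of `V`, and the Toeplitz part
`T i i' = (V - m)_{j - j'} - ε g_{i - i'}` represents multiplication by `(V - m) - ε g`. -/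
def siteMatrix {ν d : ℕ} (ωbar : Fin ν → ℝ) (V : (Fin d → ℝ) → ℝ)
    (f : (Fin ν → ℝ) → (Fin d → ℝ) → ℝ → ℝ) (u : (Fin ν → ℝ) → (Fin d → ℝ) → ℝ)
    (ε lam θ : ℝ) : Matrix (Site ν d) (Site ν d) ℂ :=
  Matrix.diagonal (fun i : Site ν d =>
      ((-(lam * (∑ a, ωbar a * (i.1 a : ℝ)) + θ) ^ 2 + ∑ a, (i.2 a : ℝ) ^ 2
        + torusMean V : ℝ) : ℂ))
    + Matrix.of (fun i i' : Site ν d =>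
        (if i.1 = i'.1 then fourierSpace (fun x => V x - torusMean V) (i.2 - i'.2) else 0)
          - (ε : ℂ) * fourierSpaceTime (linearizedCoeff f u) (i - i'))

/-- The cube of sites `i'` with `|i' - i| ≤ N`. -/
def siteBox {ν d : ℕ} (N : ℕ) (i : Site ν d) : Finset (Site ν d) :=
  Finset.Icc (fun a => i.1 a - (N : ℤ)) (fun a => i.1 a + (N : ℤ)) ×ˢ
    Finset.Icc (fun a => i.2 a - (N : ℤ)) (fun a => i.2 a + (N : ℤ))

theorem mem_siteBox {ν d : ℕ} (N : ℕ) (i i' : Site ν d) :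
    i' ∈ siteBox N i ↔ ‖i' - i‖ ≤ (N : ℝ) := by
  have hN : (0 : ℝ) ≤ N := Nat.cast_nonneg N
  have key : ∀ a b : ℤ, ‖a - b‖ ≤ (N : ℝ) ↔ b - N ≤ a ∧ a ≤ b + N := by
    intro a b
    rw [Int.norm_eq_abs, abs_le]
    constructor
    · rintro ⟨h1, h2⟩
      have h1' : -(N : ℤ) ≤ a - b := by exact_mod_cast h1
      have h2' : a - b ≤ (N : ℤ) := by exact_mod_cast h2
      omega
    · rintro ⟨h1, h2⟩
      have h1' : -(N : ℤ) ≤ a - b := by omega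
      have h2' : a - b ≤ (N : ℤ) := by omega
      exact ⟨by exact_mod_cast h1', by exact_mod_cast h2'⟩
  rw [siteBox, Finset.mem_product, Finset.mem_Icc, Finset.mem_Icc, Prod.norm_def, max_le_iff,
    pi_norm_le_iff_of_nonneg hN, pi_norm_le_iff_of_nonneg hN]
  simp only [Pi.le_def, Prod.fst_sub, Prod.snd_sub, Pi.sub_apply, key]
  constructor
  · rintro ⟨⟨h1, h2⟩, h3, h4⟩
    exact ⟨fun a => ⟨h1 a, h2 a⟩, fun a => ⟨h3 a, h4 a⟩⟩
  · rintro ⟨h1, h2⟩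
    exact ⟨⟨fun a => (h1 a).1, fun a => (h1 a).2⟩, fun a => (h2 a).1, fun a => (h2 a).2⟩

/-- The submatrix `A_{N, i}`, the restriction of `A` to the cube of radius `N` about `i`. -/
def subBox {ν d : ℕ} (A : Matrix (Site ν d) (Site ν d) ℂ) (N : ℕ) (i : Site ν d) :
    Matrix (siteBox N i) (siteBox N i) ℂ :=
  A.submatrix Subtype.val Subtype.val

/-- `[M(n)]`, the largest modulus of an entry of `M` on the diagonal `i - i' = n`
(and `0` if there is no such entry). -/
def diagSup {ν d : ℕ} {E : Finset (Site ν d)} (M : Matrix E E ℂ) (n : Site ν d) : ℝ :=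
  ⨆ p : {p : E × E // (p.1 : Site ν d) - (p.2 : Site ν d) = n}, ‖M p.1.1 p.1.2‖

/-- The `s`-norm of a matrix: `|M|_s² = K₀ ∑ₙ [M(n)]² ⟨n⟩^{2s}`, with `⟨n⟩ = max (|n|, 1)`.
Only `n ∈ E - E` contribute. -/
def sNorm {ν d : ℕ} (K₀ s : ℝ) {E : Finset (Site ν d)} (M : Matrix E E ℂ) : ℝ :=
  Real.sqrt (K₀ * ∑ n ∈ (E ×ˢ E).image (fun p => p.1 - p.2),
    diagSup M n ^ 2 * (max ‖n‖ 1) ^ (2 * s))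

/-- The numerical constants that enter the notion of an `N`-good matrix. -/
structure GoodConstants where
  K₀ : ℝ
  s₀ : ℝ
  s₁ : ℝ
  τ' : ℝ
  δ : ℝ

/-- A finite matrix is `N`-good if it is invertible and its inverse satisfies
`|M⁻¹|_s ≤ N^{τ' + δ s}` for all `s ∈ [s₀, s₁]`. -/
def IsGoodMatrix {ν d : ℕ} (c : GoodConstants) (N : ℕ) {E : Finset (Site ν d)}
    (M : Matrix E E ℂ) : Prop :=
  IsUnit M ∧ ∀ s ∈ Set.Icc c.s₀ c.s₁, sNorm c.K₀ s M⁻¹ ≤ (N : ℝ) ^ (c.τ' + c.δ * s)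

/-- The inner boundary `∂B = {j ∈ B : d(j, ℤᵈ \ B) = 1}`. -/
def latticeBoundary {d : ℕ} (B : Set (Fin d → ℤ)) : Set (Fin d → ℤ) :=
  {j | j ∈ B ∧ Metric.infDist j Bᶜ = 1}

/-- `𝒬_N = {j : d(0, ∂(j + [-N, N]ᵈ)) < L₀}`. -/
def exceptionalSites {d : ℕ} (L₀ N : ℕ) : Set (Fin d → ℤ) :=
  {j | Metric.infDist 0 (latticeBoundary (Metric.closedBall j (N : ℝ))) < (L₀ : ℝ)}

/-- A site is `N`-regular for `A` if `A_{N, i}` is an `N`-good matrix. -/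
def IsRegularSite {ν d : ℕ} (c : GoodConstants) (A : Matrix (Site ν d) (Site ν d) ℂ)
    (N : ℕ) (i : Site ν d) : Prop :=
  IsGoodMatrix c N (subBox A N i)

/-- A site `i` is `N`-good for `A` if it is regular, i.e. `|A i i| ≥ Θ`, or if, for both
`M = N - 2 L₀` and `M = N`, all sites `i' = (l', j')` with `|i' - i| ≤ M` and `j' ∉ 𝒬_M` are
`M`-regular. -/
def IsGoodSite {ν d : ℕ} (c : GoodConstants) (Θ : ℝ) (L₀ : ℕ)
    (A : Matrix (Site ν d) (Site ν d) ℂ) (N : ℕ) (i : Site ν d) : Prop :=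
  Θ ≤ ‖A i i‖ ∨
    ∀ M ∈ ({N - 2 * L₀, N} : Set ℕ), ∀ i' : Site ν d,
      ‖i' - i‖ ≤ (M : ℝ) → i'.2 ∉ exceptionalSites L₀ M → IsRegularSite c A M i'

/-- `B_M(j₀)`, the set of `θ` for which the submatrix `A_{M, (0, j₀)}(θ)` is `M`-bad, for a
family `θ ↦ A θ`. -/
def badTheta {ν d : ℕ} (c : GoodConstants) (A : ℝ → Matrix (Site ν d) (Site ν d) ℂ)
    (M : ℕ) (j₀ : Fin d → ℤ) : Set ℝ :=
  {θ | ¬ IsGoodMatrix c M (subBox (A θ) M (0, j₀))}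

/-- `N`-goodness of a parameter, as a property of the family `θ ↦ A(ε, λ, θ)` at that parameter:
for `M ∈ {N, N - 2 L₀}` and all `j₀ ∉ 𝒬_M`, the set `B_M(j₀)` is covered by
`N^{2d + ν + 3}` intervals of length at most `N^{-τ}`. -/
def IsGoodFamily {ν d : ℕ} (c : GoodConstants) (τ : ℝ) (L₀ : ℕ)
    (A : ℝ → Matrix (Site ν d) (Site ν d) ℂ) (N : ℕ) : Prop :=
  ∀ M ∈ ({N, N - 2 * L₀} : Set ℕ), ∀ j₀ : Fin d → ℤ, j₀ ∉ exceptionalSites L₀ M →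
    ∃ I : Fin (N ^ (2 * d + ν + 3)) → Set ℝ,
      (∀ q, (I q).OrdConnected ∧
        MeasureTheory.volume (I q) ≤ ENNReal.ofReal ((N : ℝ) ^ (-τ))) ∧
      badTheta c A M j₀ ⊆ ⋃ q, I q

/-- The Diophantine condition `|ω̄·l| ≥ 2 γ₀ / |l|^ν` for all nonzero integer vectors `l`. -/
def IsDiophantine {ν : ℕ} (γ₀ : ℝ) (ωbar : Fin ν → ℝ) : Prop :=
  ∀ l : Fin ν → ℤ, l ≠ 0 → 2 * γ₀ / ‖l‖ ^ ν ≤ |∑ a, ωbar a * (l a : ℝ)|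

/-- The index set of the pairs `i ≤ j`, of cardinality `ν (ν + 1) / 2`. -/
abbrev UpperPair (ν : ℕ) : Type := {q : Fin ν × Fin ν // q.1 ≤ q.2}

/-- The quadratic non-resonance condition with constant `γ` and exponent `τ₀ = ν (ν + 1)`:
`|n + ∑_{i ≤ j} p_{ij} ω_i ω_j| ≥ γ / (1 + |p|^{τ₀})` for all integers `(n, p) ≠ 0`. -/
def QuadraticNonresonance {ν : ℕ} (γ : ℝ) (ω : Fin ν → ℝ) : Prop :=
  ∀ (n : ℤ) (p : UpperPair ν → ℤ), (n ≠ 0 ∨ p ≠ 0) →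
    γ / (1 + ‖p‖ ^ (ν * (ν + 1))) ≤
      |(n : ℝ) + ∑ q : UpperPair ν, (p q : ℝ) * (ω q.1.1 * ω q.1.2)|

/-- The `N`-bad sites `(l, j)` of `A` with `|l| ≤ R`. -/
def badSites {ν d : ℕ} (c : GoodConstants) (Θ : ℝ) (L₀ : ℕ)
    (A : Matrix (Site ν d) (Site ν d) ℂ) (N : ℕ) (R : ℝ) : Set (Site ν d) :=
  {i | ¬ IsGoodSite c Θ L₀ A N i ∧ ‖i.1‖ ≤ R}

/-- `P` is a partition of `S` into nonempty, pairwise disjoint clusters, each of diameter at most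
`D`, with any two distinct clusters at distance greater than `ρ`. (Distances between sites are
integers, so a strict bound for all pairs is a strict bound for their infimum.) -/
def IsSeparatedPartition {ν d : ℕ} (S : Set (Site ν d)) (D ρ : ℝ)
    (P : Set (Set (Site ν d))) : Prop :=
  (∀ Ω ∈ P, Ω.Nonempty) ∧ P.PairwiseDisjoint id ∧ ⋃₀ P = S ∧
    (∀ Ω ∈ P, ∀ i ∈ Ω, ∀ i' ∈ Ω, ‖i - i'‖ ≤ D) ∧
    (∀ Ω ∈ P, ∀ Ω' ∈ P, Ω ≠ Ω' → ∀ i ∈ Ω, ∀ i' ∈ Ω', ρ < ‖i - i'‖)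

end

noncomputable section

/-! To a site (l, j) attach the vector (ω·l + θ, j) in ℝ × ℝ^d, with the Lorentzian form Q(x, j) =
-x² + ‖j‖². The Toeplitz part has constant diagonal, so the diagonal of A is Q plus a constant. Bad
sites have diagonal entry below Θ in modulus, hence their values of Q differ by at most 2Θ. It
suffices to bound polynomially the length of injective chains of bad sites with steps at most N²:
the clusters are then the connected components.

Two facts control a chain. First, few bad sites share one j (`card_badSites_fiber_le`). Near each of
them is a bad box, which puts θ + ω·l' in one of polynomially many short intervals. By the
Diophantine condition each interval contains at most one such value.

Second, the j's along a chain stay in a box of polynomial size (`exists_chain_length_le`, by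
induction on the dimension of the span G of differences). A window longer than the bound for smaller
dimension already spans G, so G has a basis of differences with polynomially bounded integer data.
The Gram determinant of Q on this basis is n - P(ω), with n an integer and P an integral quadratic
form: the time component enters as a rank-one perturbation, so nothing of higher degree appears. The
Euclidean Gram determinant is n + P(ω), nonzero by independence, so the coefficients are not all
zero and (NR) bounds n - P(ω) from below (`le_abs_det_gramMatrix`). Thus Q is quantitatively
nondegenerate on G. Since Q is nearly constant on the chain, polarization bounds the products of a
site vector with the basis, and Cramer's rule bounds its Q-orthogonal projection onto G
(`exists_waveForm_projection`). A difference of two site vectors lies in G, so it equals the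
difference of their projections. Counting fibres over the box bounds the length. At most d + 1
dimensions occur, so the final exponent depends on d and ν only. -/

/-! ### Gram determinants as integral quadratic polynomials in the frequencies -/

/-- The matrix determinant lemma, without an invertibility assumption. -/
theorem det_add_vecMulVec_adjugate {ι : Type*} [Fintype ι] [DecidableEq ι] (A : Matrix ι ι ℝ)
    (u v : ι → ℝ) :
    (A + Matrix.vecMulVec u v).det = A.det + v ⬝ᵥ (A.adjugate.mulVec u) := by
  have hinv : ∀ B : Matrix ι ι ℝ, B.det ≠ 0 →
      (B + Matrix.vecMulVec u v).det = B.det + v ⬝ᵥ (B.adjugate.mulVec u) := by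
    intro B hB
    rw [Matrix.vecMulVec_eq Unit, Matrix.det_add_replicateCol_mul_replicateRow (hB.isUnit),
      Matrix.det_unique (n := Unit), Matrix.inv_def, Ring.inverse_eq_inv']
    simp only [Matrix.add_apply, Matrix.one_apply_eq, Matrix.mul_smul, Matrix.smul_mul,
      Matrix.smul_apply, smul_eq_mul, mul_add, mul_one, mul_inv_cancel_left₀ hB]
    congr 1
    rw [Matrix.mul_assoc]
    simp [Matrix.mul_apply, dotProduct, Matrix.mulVec]
  -- `F s` is s·1 + A, singular only when s is an eigenvalue of -A. Both sides are continuous in s,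
  -- so the identity extends from the dense set of invertible `F s` to s = 0.
  let F : ℝ → Matrix ι ι ℝ := fun s => Matrix.scalar ι s - (-A)
  have hF : Continuous F := by
    refine continuous_matrix fun i j => ?_
    simp only [F, Matrix.sub_apply, Matrix.scalar_apply, Matrix.diagonal_apply]
    split_ifs <;> fun_prop
  have hdense : Dense {s : ℝ | (F s).det ≠ 0} := by
    have hfin : {s : ℝ | (F s).det = 0}.Finite := by
      refine ((-A).charpoly.roots.toFinset.finite_toSet).subset fun s hs => ?_
      have h0 : (-A).charpoly ≠ 0 := (Matrix.charpoly_monic _).ne_zero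
      simp only [Finset.mem_coe, Multiset.mem_toFinset, Polynomial.mem_roots h0,
        Polynomial.IsRoot.def, Matrix.eval_charpoly]
      exact hs
    exact hfin.countable.dense_compl ℝ
  have key := Continuous.ext_on (f := fun s => (F s + Matrix.vecMulVec u v).det)
    (g := fun s => (F s).det + v ⬝ᵥ ((F s).adjugate.mulVec u)) hdense
    (by fun_prop) (by
      have h1 : Continuous fun s => (F s).adjugate := hF.matrix_adjugate
      fun_prop) (fun s hs => hinv _ hs)
  have h0 := congrFun key 0
  simpa [F] using h0

/-- A double sum with symmetric weights as a sum over pairs `a ≤ b`. -/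
theorem sum_sum_eq_sum_upperPair {ν : ℕ} (P : Fin ν → Fin ν → ℤ) (ω : Fin ν → ℝ) :
    ∑ a, ∑ b, (P a b : ℝ) * (ω a * ω b) =
      ∑ q : UpperPair ν, (((if q.1.1 = q.1.2 then P q.1.1 q.1.2
        else P q.1.1 q.1.2 + P q.1.2 q.1.1 : ℤ)) : ℝ) * (ω q.1.1 * ω q.1.2) := by
  have h1 : ∑ q : UpperPair ν, (((if q.1.1 = q.1.2 then P q.1.1 q.1.2
        else P q.1.1 q.1.2 + P q.1.2 q.1.1 : ℤ)) : ℝ) * (ω q.1.1 * ω q.1.2) =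
      ∑ q ∈ Finset.univ.filter (fun q : Fin ν × Fin ν => q.1 ≤ q.2),
        (((if q.1 = q.2 then P q.1 q.2 else P q.1 q.2 + P q.2 q.1 : ℤ)) : ℝ) *
          (ω q.1 * ω q.2) := by
    symm
    exact Finset.sum_subtype _ (by simp)
      (fun q : Fin ν × Fin ν => (((if q.1 = q.2 then P q.1 q.2 else P q.1 q.2 + P q.2 q.1 : ℤ)) : ℝ) *
          (ω q.1 * ω q.2))
  rw [h1, Finset.sum_filter, Fintype.sum_prod_type]
  have h2 : ∀ a b : Fin ν, (if a ≤ b then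
      (((if a = b then P a b else P a b + P b a : ℤ)) : ℝ) * (ω a * ω b) else 0) =
      (if a ≤ b then (P a b : ℝ) * (ω a * ω b) else 0) +
      (if a < b then (P b a : ℝ) * (ω b * ω a) else 0) := by
    intro a b
    rcases lt_trichotomy a b with h | h | h
    · simp only [h.le, h, h.ne, if_true, if_false]; push_cast; ring
    · subst h; simp
    · simp [h.not_ge, h.not_gt]
  simp only [h2, Finset.sum_add_distrib]
  rw [Finset.sum_comm (f := fun a b : Fin ν => if a < b then (P b a : ℝ) * (ω b * ω a) else 0),
    ← Finset.sum_add_distrib]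
  refine Finset.sum_congr rfl fun a _ => ?_
  rw [← Finset.sum_add_distrib]
  refine Finset.sum_congr rfl fun b _ => ?_
  rcases le_or_gt a b with h | h
  · simp [h, h.not_gt]
  · simp [h, h.not_ge]

/-- The entries of the adjugate of a matrix with entries bounded by `x ≥ 1`. -/
theorem abs_adjugate_apply_le {ι R : Type*} [Fintype ι] [DecidableEq ι] [CommRing R]
    [LinearOrder R] [IsStrictOrderedRing R]
    (A : Matrix ι ι R) {x : R} (hx : 1 ≤ x) (h : ∀ i j, |A i j| ≤ x) (i j : ι) :
    |A.adjugate i j| ≤ (Fintype.card ι).factorial * x ^ Fintype.card ι := by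
  -- An entry of the adjugate is the determinant of A with one row replaced by a unit vector; the
  -- entries 0 and 1 of that row are why 1 ≤ x is needed.
  rw [Matrix.adjugate_apply]
  have := Matrix.det_le (A := A.updateRow j (Pi.single i 1)) (abv := AbsoluteValue.abs) (x := x) ?_
  · simpa [nsmul_eq_mul] using this
  · intro a b
    simp only [AbsoluteValue.abs_apply, Matrix.updateRow_apply]
    split_ifs with h1
    · rw [Pi.single_apply]; split_ifs <;> simp <;> linarith
    · exact h a b

/-- The Gram matrix of the vectors `(x b, J b)` for the form `(x, j) ↦ t x² + ‖j‖²`. -/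
def gramMatrix {ι : Type*} {d : ℕ} (t : ℝ) (J : Matrix ι (Fin d) ℤ) (x : ι → ℝ) : Matrix ι ι ℝ :=
  (J * J.transpose).map (Int.cast : ℤ → ℝ) + Matrix.vecMulVec (t • x) x

theorem gramMatrix_apply {ι : Type*} {d : ℕ} (t : ℝ) (J : Matrix ι (Fin d) ℤ) (x : ι → ℝ)
    (b b' : ι) :
    gramMatrix t J x b b' = t * (x b * x b') + ∑ k, (J b k : ℝ) * (J b' k : ℝ) := by
  simp [gramMatrix, Matrix.mul_apply, Matrix.vecMulVec_apply]
  ring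

/-- The integer coefficients of the determinant of the Gram matrix as a quadratic form in the
frequencies. -/
def gramCoeff {ι : Type*} [Fintype ι] [DecidableEq ι] {d ν : ℕ} (J : Matrix ι (Fin d) ℤ)
    (Lm : Matrix ι (Fin ν) ℤ) : Matrix (Fin ν) (Fin ν) ℤ :=
  Lm.transpose * (J * J.transpose).adjugate * Lm

/-- The dependence on ω is a rank-one term, so the determinant is affine in t and quadratic in ω.
The integer matrix J Jᵀ may be singular (always so for d + 1 vectors), hence the adjugate form of
the determinant lemma. The values t = 1 and t = -1 share the same integer coefficients. -/
theorem det_gramMatrix {ι : Type*} [Fintype ι] [DecidableEq ι] {d ν : ℕ} (t : ℝ)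
    (J : Matrix ι (Fin d) ℤ) (Lm : Matrix ι (Fin ν) ℤ) (ω : Fin ν → ℝ) :
    (gramMatrix t J (fun b => ∑ a, ω a * (Lm b a : ℝ))).det =
      ((J * J.transpose).det : ℝ) +
        t * ∑ a, ∑ a', (gramCoeff J Lm a a' : ℝ) * (ω a * ω a') := by
  have hx : (fun b => ∑ a, ω a * (Lm b a : ℝ)) = (Lm.map (Int.cast : ℤ → ℝ)).mulVec ω := by
    ext b; simp [Matrix.mulVec, dotProduct, mul_comm]
  have hdet : ((J * J.transpose).map (Int.cast : ℤ → ℝ)).det = ((J * J.transpose).det : ℝ) :=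
    ((Int.castRingHom ℝ).map_det _).symm
  have hadj : ((J * J.transpose).map (Int.cast : ℤ → ℝ)).adjugate =
      (J * J.transpose).adjugate.map (Int.cast : ℤ → ℝ) :=
    ((Int.castRingHom ℝ).map_adjugate _).symm
  have hP : (gramCoeff J Lm).map (Int.cast : ℤ → ℝ) = (Lm.map (Int.cast : ℤ → ℝ)).transpose *
      (J * J.transpose).adjugate.map (Int.cast : ℤ → ℝ) * Lm.map (Int.cast : ℤ → ℝ) := by
    have e1 := Matrix.map_mul (f := Int.castRingHom ℝ)
      (L := Lm.transpose * (J * J.transpose).adjugate) (M := Lm)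
    have e2 := Matrix.map_mul (f := Int.castRingHom ℝ)
      (L := Lm.transpose) (M := (J * J.transpose).adjugate)
    rw [e2] at e1
    exact e1
  rw [gramMatrix, det_add_vecMulVec_adjugate, hdet, hadj, hx, Matrix.mulVec_smul,
    dotProduct_smul, smul_eq_mul]
  congr 2
  have h3 : ∑ a, ∑ a', (gramCoeff J Lm a a' : ℝ) * (ω a * ω a') =
      ω ⬝ᵥ ((gramCoeff J Lm).map (Int.cast : ℤ → ℝ)).mulVec ω := by
    simp only [dotProduct, Matrix.mulVec, Matrix.map_apply, Finset.mul_sum]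
    exact Finset.sum_congr rfl fun a _ => Finset.sum_congr rfl fun b _ => by ring
  rw [h3, hP, ← Matrix.mulVec_mulVec, ← Matrix.mulVec_mulVec, Matrix.dotProduct_mulVec ω,
    Matrix.vecMul_transpose]

/-- For t = 1 the form is Euclidean: a kernel vector c makes a sum of squares vanish, which is a
linear dependence. -/
theorem det_gramMatrix_one_ne_zero {ι : Type*} [Fintype ι] [DecidableEq ι] {d : ℕ}
    (J : Matrix ι (Fin d) ℤ) (x : ι → ℝ)
    (hli : ∀ c : ι → ℝ, ∑ b, c b * x b = 0 → (∀ k, ∑ b, c b * (J b k : ℝ) = 0) → c = 0) :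
    (gramMatrix 1 J x).det ≠ 0 := by
  intro h
  obtain ⟨c, hc, h0⟩ := Matrix.exists_mulVec_eq_zero_iff.mpr h
  refine hc ?_
  have hsum : (∑ b, c b * x b) ^ 2 + ∑ k, (∑ b, c b * (J b k : ℝ)) ^ 2 = 0 := by
    have h1 : c ⬝ᵥ (gramMatrix 1 J x).mulVec c = 0 := by rw [h0]; simp
    rw [← h1]
    simp only [dotProduct, Matrix.mulVec, gramMatrix_apply, one_mul, sq, Finset.sum_mul_sum]
    rw [Finset.sum_comm (s := (Finset.univ : Finset (Fin d)))]
    rw [← Finset.sum_add_distrib]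
    refine Finset.sum_congr rfl fun b _ => ?_
    rw [Finset.sum_comm, ← Finset.sum_add_distrib, Finset.mul_sum]
    refine Finset.sum_congr rfl fun b' _ => ?_
    rw [add_mul, mul_add, Finset.sum_mul, Finset.mul_sum]
    congr 1
    · ring
    · exact Finset.sum_congr rfl fun k _ => by ring
  have hn : 0 ≤ ∑ k, (∑ b, c b * (J b k : ℝ)) ^ 2 := Finset.sum_nonneg fun k _ => sq_nonneg _
  have hz : ∑ k, (∑ b, c b * (J b k : ℝ)) ^ 2 = 0 := by nlinarith [sq_nonneg (∑ b, c b * x b)]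
  refine hli c ?_ fun k => ?_
  · rw [hz, add_zero] at hsum
    exact pow_eq_zero_iff (two_ne_zero) |>.mp hsum
  · have := (Finset.sum_eq_zero_iff_of_nonneg (fun k _ => sq_nonneg _)).mp hz k (Finset.mem_univ k)
    exact pow_eq_zero_iff (two_ne_zero) |>.mp this

/-! ### Polynomial bounds and the use of the non-resonance condition -/

theorem abs_sum_le_of_le {ι : Type*} [Fintype ι] (f : ι → ℝ) {A B : ℝ}
    (hA : (Fintype.card ι : ℝ) ≤ A) (hB : 0 ≤ B) (h : ∀ i, |f i| ≤ B) : |∑ i, f i| ≤ A * B := by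
  calc |∑ i, f i| ≤ ∑ i, |f i| := Finset.abs_sum_le_sum_abs _ _
    _ ≤ ∑ _i : ι, B := Finset.sum_le_sum fun i _ => h i
    _ = Fintype.card ι * B := by simp
    _ ≤ A * B := by gcongr

/-- Lower bound for the quadratic polynomial in the frequencies, provided it is not identically
zero, from the non-resonance condition. -/
theorem QuadraticNonresonance.le_abs {ν : ℕ} {γ : ℝ} {ω : Fin ν → ℝ} (hγ : 0 < γ)
    (h : QuadraticNonresonance γ ω) (n : ℤ) (P : Fin ν → Fin ν → ℤ) {B : ℝ}
    (hP : ∀ a b, |(P a b : ℝ)| ≤ B) (hB : 0 ≤ B)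
    (hne : (n : ℝ) + ∑ a, ∑ b, (P a b : ℝ) * (ω a * ω b) ≠ 0) :
    γ / (1 + (2 * B) ^ (ν * (ν + 1))) ≤ |(n : ℝ) - ∑ a, ∑ b, (P a b : ℝ) * (ω a * ω b)| := by
  rw [sum_sum_eq_sum_upperPair] at hne ⊢
  set p : UpperPair ν → ℤ := fun q => if q.1.1 = q.1.2 then P q.1.1 q.1.2
        else P q.1.1 q.1.2 + P q.1.2 q.1.1 with hp
  have hnp : n ≠ 0 ∨ -p ≠ 0 := by
    by_contra! hcon
    obtain ⟨h1, h2⟩ := hcon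
    apply hne
    have h3 : ∀ q, p q = 0 := fun q => by
      have := congrFun h2 q
      simpa using this
    change (n : ℝ) + ∑ q : UpperPair ν, (p q : ℝ) * (ω q.1.1 * ω q.1.2) = 0
    simp [h1, h3]
  -- Non-vanishing with the plus sign makes (n, p) nonzero; the condition is then applied to (n,
  -- -p), which gives the minus sign.
  have key := h n (-p) hnp
  have hnorm : ‖-p‖ ≤ 2 * B := by
    rw [norm_neg, pi_norm_le_iff_of_nonneg (by positivity)]
    intro q
    rw [Int.norm_eq_abs]
    simp only [hp]
    split_ifs
    · exact (hP _ _).trans (by linarith)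
    · push_cast
      exact (abs_add_le _ _).trans (by linarith [hP q.1.1 q.1.2, hP q.1.2 q.1.1])
  have e : (n : ℝ) + ∑ q : UpperPair ν, ((-p) q : ℝ) * (ω q.1.1 * ω q.1.2) =
      (n : ℝ) - ∑ q : UpperPair ν, (p q : ℝ) * (ω q.1.1 * ω q.1.2) := by
    simp [Finset.sum_neg_distrib, sub_eq_add_neg]
  rw [e] at key
  refine le_trans ?_ key
  gcongr

/-- Entries of the coefficient matrix are polynomially bounded. -/
theorem abs_gramCoeff_le {ι : Type*} [Fintype ι] [DecidableEq ι] {d ν : ℕ} {R : ℝ}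
    (hR : ((d + 1).factorial : ℝ) + 2 * ν + 2 ≤ R) (hι : Fintype.card ι ≤ d + 1)
    (J : Matrix ι (Fin d) ℤ) (Lm : Matrix ι (Fin ν) ℤ)
    (hJ : ∀ b k, |(J b k : ℝ)| ≤ R) (hL : ∀ b a, |(Lm b a : ℝ)| ≤ R) (a a' : Fin ν) :
    |(gramCoeff J Lm a a' : ℝ)| ≤ R ^ (3 * d + 8) := by
  have hfac : (1 : ℝ) ≤ ((d + 1).factorial : ℝ) := by
    exact_mod_cast Nat.one_le_iff_ne_zero.mpr (Nat.factorial_ne_zero _)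
  have hν : (0 : ℝ) ≤ ν := Nat.cast_nonneg ν
  have hR1 : 1 ≤ R := by linarith
  have hd : ((d : ℝ) + 1) ≤ R := by
    have : ((d + 1 : ℕ) : ℝ) ≤ ((d + 1).factorial : ℝ) := by exact_mod_cast Nat.self_le_factorial _
    push_cast at this
    linarith
  have hcard : (Fintype.card ι : ℝ) ≤ R := by
    have : (Fintype.card ι : ℝ) ≤ ((d + 1 : ℕ) : ℝ) := by exact_mod_cast hι
    push_cast at this
    linarith
  have hG : ∀ b b', |(J * J.transpose).map (Int.cast : ℤ → ℝ) b b'| ≤ R ^ 3 := by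
    intro b b'
    simp only [Matrix.map_apply, Matrix.mul_apply, Matrix.transpose_apply]
    push_cast
    refine (abs_sum_le_of_le (A := R) (B := R * R) _ (by simp; linarith) (by positivity) ?_).trans
      (by ring_nf; rfl)
    intro k
    rw [abs_mul]
    exact mul_le_mul (hJ _ _) (hJ _ _) (abs_nonneg _) (by linarith)
  have hadj : ∀ b b', |((J * J.transpose).adjugate b b' : ℝ)| ≤ R ^ (3 * d + 4) := by
    intro b b'
    have h1 := abs_adjugate_apply_le _ (one_le_pow₀ hR1) hG b b'
    have hadj : ((J * J.transpose).map (Int.cast : ℤ → ℝ)).adjugate =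
        (J * J.transpose).adjugate.map (Int.cast : ℤ → ℝ) :=
      ((Int.castRingHom ℝ).map_adjugate _).symm
    rw [hadj, Matrix.map_apply] at h1
    refine h1.trans ?_
    calc ((Fintype.card ι).factorial : ℝ) * (R ^ 3) ^ Fintype.card ι
        ≤ ((d + 1).factorial : ℝ) * (R ^ 3) ^ (d + 1) := by
          have : ((Fintype.card ι).factorial : ℝ) ≤ ((d + 1).factorial : ℝ) := by
            exact_mod_cast Nat.factorial_le hι
          gcongr
          exact one_le_pow₀ hR1
      _ ≤ R * (R ^ 3) ^ (d + 1) := by gcongr; linarith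
      _ = R ^ (3 * d + 4) := by ring
  simp only [gramCoeff, Matrix.mul_apply, Matrix.transpose_apply]
  push_cast
  have hR0 : 0 ≤ R := by linarith
  refine (abs_sum_le_of_le (A := R) (B := R ^ (3 * d + 6) * R) _ hcard (by positivity) ?_).trans
    (by ring_nf; rfl)
  intro b
  rw [abs_mul]
  refine mul_le_mul ?_ (hL _ _) (abs_nonneg _) (by positivity)
  refine (abs_sum_le_of_le (A := R) (B := R * R ^ (3 * d + 4)) _ hcard (by positivity) ?_).trans
    (by ring_nf; rfl)
  intro b'
  rw [abs_mul]
  exact mul_le_mul (hL _ _) (hadj _ _) (abs_nonneg _) (by positivity)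

/-! ### The Lorentzian form and projections onto spans of differences -/

/-- The bilinear form of signature `(d, 1)` on `ℝ × ℝᵈ` whose quadratic form is `-x² + ‖j‖²`. -/
def waveForm (d : ℕ) : (ℝ × (Fin d → ℝ)) →ₗ[ℝ] (ℝ × (Fin d → ℝ)) →ₗ[ℝ] ℝ :=
  LinearMap.mk₂ ℝ (fun v w => -(v.1 * w.1) + ∑ k, v.2 k * w.2 k)
    (fun u v w => by simp [add_mul, Finset.sum_add_distrib]; ring)
    (fun c v w => by simp [mul_add, Finset.mul_sum, mul_assoc])
    (fun u v w => by simp [mul_add, Finset.sum_add_distrib]; ring)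
    (fun c v w => by simp [mul_add, Finset.mul_sum, mul_left_comm])

theorem waveForm_apply {d : ℕ} (v w : ℝ × (Fin d → ℝ)) :
    waveForm d v w = -(v.1 * w.1) + ∑ k, v.2 k * w.2 k := rfl

theorem waveForm_comm {d : ℕ} (v w : ℝ × (Fin d → ℝ)) : waveForm d v w = waveForm d w v := by
  simp only [waveForm_apply, mul_comm]

/-- The vector `(ω·l + θ, j)` attached to the site `(l, j)`. -/
def siteVec {ν d : ℕ} (ω : Fin ν → ℝ) (θ : ℝ) (i : Site ν d) : ℝ × (Fin d → ℝ) :=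
  (∑ a, ω a * (i.1 a : ℝ) + θ, fun k => (i.2 k : ℝ))

/-- The exponent in the bound for the projection of a site vector. -/
def projExponent (d ν : ℕ) : ℕ := (3 * d + 9) * (ν * (ν + 1)) + 5 * d + 20

/-- Under the non-resonance condition, the determinant of a Gram matrix for `waveForm` of
independent vectors with integer data bounded by `R` is bounded below by a power of `R⁻¹`. -/
theorem le_abs_det_gramMatrix {ι : Type*} [Fintype ι] [DecidableEq ι] {d ν : ℕ} {R γ : ℝ}
    (hR : ((d + 1).factorial : ℝ) + 2 * ν + 2 ≤ R) (hι : Fintype.card ι ≤ d + 1)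
    (hγ : 0 < γ) (hγR : 1 ≤ γ * R) {ω : Fin ν → ℝ} (hNR : QuadraticNonresonance γ ω)
    (J : Matrix ι (Fin d) ℤ) (Lm : Matrix ι (Fin ν) ℤ)
    (hJ : ∀ b k, |(J b k : ℝ)| ≤ R) (hL : ∀ b a, |(Lm b a : ℝ)| ≤ R)
    (hli : ∀ c : ι → ℝ, ∑ b, c b * ∑ a, ω a * (Lm b a : ℝ) = 0 →
      (∀ k, ∑ b, c b * (J b k : ℝ) = 0) → c = 0) :
    1 ≤ |(gramMatrix (-1) J (fun b => ∑ a, ω a * (Lm b a : ℝ))).det| *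
      R ^ ((3 * d + 9) * (ν * (ν + 1)) + 2) := by
  have hfac : (1 : ℝ) ≤ ((d + 1).factorial : ℝ) := by
    exact_mod_cast Nat.one_le_iff_ne_zero.mpr (Nat.factorial_ne_zero _)
  have hν : (0 : ℝ) ≤ ν := Nat.cast_nonneg ν
  have hR2 : 2 ≤ R := by linarith
  -- The Lorentzian determinant could a priori vanish; the Euclidean one cannot, and this excludes
  -- that all integer coefficients are zero.
  have hne := det_gramMatrix_one_ne_zero J _ hli
  rw [det_gramMatrix, one_mul] at hne
  have key := hNR.le_abs hγ (J * J.transpose).det (gramCoeff J Lm)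
    (abs_gramCoeff_le hR hι J Lm hJ hL) (by positivity) hne
  have e : (gramMatrix (-1) J (fun b => ∑ a, ω a * (Lm b a : ℝ))).det =
      ((J * J.transpose).det : ℝ) -
        ∑ a, ∑ a', (gramCoeff J Lm a a' : ℝ) * (ω a * ω a') := by
    rw [det_gramMatrix]; ring
  rw [← e] at key
  set D := |(gramMatrix (-1) J (fun b => ∑ a, ω a * (Lm b a : ℝ))).det|
  set T := ν * (ν + 1)
  have hR0 : 0 ≤ R := by linarith
  have h1 : 1 + (2 * R ^ (3 * d + 8)) ^ T ≤ R ^ ((3 * d + 9) * T + 1) := by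
    have h2 : 2 * R ^ (3 * d + 8) ≤ R ^ (3 * d + 9) := by
      calc 2 * R ^ (3 * d + 8) ≤ R * R ^ (3 * d + 8) := by gcongr
        _ = R ^ (3 * d + 9) := by ring
    have h3 : (2 * R ^ (3 * d + 8)) ^ T ≤ R ^ ((3 * d + 9) * T) := by
      rw [pow_mul R]; gcongr
    have h4 : 1 ≤ R ^ ((3 * d + 9) * T) := one_le_pow₀ (by linarith)
    calc _ ≤ R ^ ((3 * d + 9) * T) * 2 := by linarith
      _ ≤ R ^ ((3 * d + 9) * T) * R := by gcongr
      _ = _ := (pow_succ _ _).symm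
  have hpos : 0 < 1 + (2 * R ^ (3 * d + 8)) ^ T := by positivity
  rw [div_le_iff₀ hpos] at key
  have hD : 0 ≤ D := abs_nonneg _
  calc (1 : ℝ) ≤ γ * R := hγR
    _ ≤ (D * (1 + (2 * R ^ (3 * d + 8)) ^ T)) * R := by gcongr
    _ ≤ (D * R ^ ((3 * d + 9) * T + 1)) * R := by gcongr
    _ = D * R ^ ((3 * d + 9) * T + 2) := by ring

theorem abs_gramMatrix_le {ι : Type*} [Fintype ι] {d ν : ℕ} {R : ℝ} (hR2 : 2 ≤ R)
    (hdR : (d : ℝ) + 1 ≤ R) (hνR : 2 * (ν : ℝ) ≤ R) {ω : Fin ν → ℝ} (hω : ∀ a, |ω a| ≤ 2)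
    (J : Matrix ι (Fin d) ℤ) (Lm : Matrix ι (Fin ν) ℤ)
    (hJ : ∀ b k, |(J b k : ℝ)| ≤ R) (hL : ∀ b a, |(Lm b a : ℝ)| ≤ R) (b b' : ι) :
    |gramMatrix (-1) J (fun b => ∑ a, ω a * (Lm b a : ℝ)) b b'| ≤ R ^ 5 := by
  have hR0 : 0 ≤ R := by linarith
  have hR1 : 1 ≤ R := by linarith
  rw [gramMatrix_apply]
  have hx : ∀ b, |∑ a, ω a * (Lm b a : ℝ)| ≤ R ^ 2 := by
    intro b
    refine (abs_sum_le_of_le (A := (ν : ℝ)) (B := 2 * R) _ (by simp) (by positivity) ?_).trans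
      (by nlinarith)
    intro a
    rw [abs_mul]
    exact mul_le_mul (hω a) (hL b a) (abs_nonneg _) (by norm_num)
  have h1 : |(-1 : ℝ) * ((∑ a, ω a * (Lm b a : ℝ)) * ∑ a, ω a * (Lm b' a : ℝ))| ≤ R ^ 4 := by
    rw [abs_mul, abs_mul, abs_neg, abs_one, one_mul]
    calc _ ≤ R ^ 2 * R ^ 2 := mul_le_mul (hx b) (hx b') (abs_nonneg _) (by positivity)
      _ = R ^ 4 := by ring
  have h2 : |∑ k, (J b k : ℝ) * (J b' k : ℝ)| ≤ R ^ 3 := by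
    refine (abs_sum_le_of_le (A := R) (B := R * R) _ (by simp; linarith) (by positivity) ?_).trans
      (by ring_nf; rfl)
    intro k
    rw [abs_mul]
    exact mul_le_mul (hJ _ _) (hJ _ _) (abs_nonneg _) hR0
  have h3 : R ^ 3 ≤ R ^ 4 := pow_le_pow_right₀ hR1 (by norm_num)
  calc _ ≤ R ^ 4 + R ^ 3 := (abs_add_le _ _).trans (add_le_add h1 h2)
    _ ≤ R ^ 4 * 2 := by linarith
    _ ≤ R ^ 4 * R := by gcongr
    _ = R ^ 5 := by ring

/-- Cramer's rule with polynomial bounds. -/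
theorem exists_mulVec_eq_of_det {κ : Type*} [Fintype κ] [DecidableEq κ] {d T : ℕ} {R : ℝ}
    (hR : ((d + 1).factorial : ℝ) ≤ R) (hcard : Fintype.card κ ≤ d + 1) (D : Matrix κ κ ℝ)
    (hDle : ∀ b b', |D b b'| ≤ R ^ 5) (hdet : 1 ≤ |D.det| * R ^ T) (y : κ → ℝ)
    (hy : ∀ b, |y b| ≤ R ^ 6) :
    ∃ c : κ → ℝ, D.mulVec c = y ∧ ∀ b, |c b| ≤ R ^ (T + 5 * d + 13) := by
  have hdR : ((d + 1 : ℕ) : ℝ) ≤ R :=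
    le_trans (by exact_mod_cast Nat.self_le_factorial _) hR
  have hcardR : (Fintype.card κ : ℝ) ≤ R := le_trans (by exact_mod_cast hcard) hdR
  have hR1 : 1 ≤ R := by
    push_cast at hdR
    linarith [(Nat.cast_nonneg d : (0 : ℝ) ≤ d)]
  have hR0 : 0 ≤ R := by linarith
  have hdet0 : D.det ≠ 0 := by
    intro h
    rw [h, abs_zero, zero_mul] at hdet
    linarith
  refine ⟨D.det⁻¹ • D.adjugate.mulVec y, ?_, fun b => ?_⟩
  · rw [Matrix.mulVec_smul, Matrix.mulVec_mulVec, Matrix.mul_adjugate, Matrix.smul_mulVec,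
      Matrix.one_mulVec, smul_smul, inv_mul_cancel₀ hdet0, one_smul]
  have hadj : ∀ b b', |D.adjugate b b'| ≤ R ^ (5 * d + 6) := by
    intro b b'
    refine (abs_adjugate_apply_le _ (one_le_pow₀ hR1) hDle b b').trans ?_
    calc ((Fintype.card κ).factorial : ℝ) * (R ^ 5) ^ Fintype.card κ
        ≤ ((d + 1).factorial : ℝ) * (R ^ 5) ^ (d + 1) := by
          have : ((Fintype.card κ).factorial : ℝ) ≤ ((d + 1).factorial : ℝ) := by
            exact_mod_cast Nat.factorial_le hcard
          gcongr
          exact one_le_pow₀ hR1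
      _ ≤ R * (R ^ 5) ^ (d + 1) := by gcongr
      _ = R ^ (5 * d + 6) := by ring
  have hinv : |D.det⁻¹| ≤ R ^ T := by
    rw [abs_inv, inv_le_iff_one_le_mul₀ (abs_pos.mpr hdet0), mul_comm]
    exact hdet
  rw [Pi.smul_apply, smul_eq_mul, abs_mul]
  have hsum : |D.adjugate.mulVec y b| ≤ R * (R ^ (5 * d + 6) * R ^ 6) := by
    refine abs_sum_le_of_le _ hcardR (by positivity) fun b' => ?_
    rw [abs_mul]
    exact mul_le_mul (hadj _ _) (hy _) (abs_nonneg _) (by positivity)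
  calc _ ≤ R ^ T * (R * (R ^ (5 * d + 6) * R ^ 6)) :=
        mul_le_mul hinv hsum (abs_nonneg _) (by positivity)
    _ = R ^ (T + 5 * d + 13) := by ring

/-- Polarization: near equality of the quadratic form at v and w turns into a bound for the product
of v - w with w. -/
theorem waveForm_self_sub {d : ℕ} (v w : ℝ × (Fin d → ℝ)) :
    waveForm d v v - waveForm d w w = waveForm d (v - w) (v - w) + 2 * waveForm d (v - w) w := by
  simp only [map_sub, LinearMap.sub_apply]
  rw [waveForm_comm w v]
  ring

theorem finrank_prod_pi (d : ℕ) : Module.finrank ℝ (ℝ × (Fin d → ℝ)) = d + 1 := by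
  rw [Module.finrank_prod, Module.finrank_fin_fun, Module.finrank_self, add_comm]

theorem siteVec_sub {ν d : ℕ} (ω : Fin ν → ℝ) (θ : ℝ) (i i' : Site ν d) :
    siteVec ω θ i - siteVec ω θ i' =
      (∑ a, ω a * ((i.1 a - i'.1 a : ℤ) : ℝ), fun k => ((i.2 k - i'.2 k : ℤ) : ℝ)) := by
  ext
  · simp [siteVec, mul_sub]
  · simp [siteVec]

theorem abs_intCast_sub_le_of_norm_le {ν d : ℕ} {R : ℝ} {i i' : Site ν d} (h : ‖i - i'‖ ≤ R) :
    (∀ a, |((i.1 a - i'.1 a : ℤ) : ℝ)| ≤ R) ∧ ∀ k, |((i.2 k - i'.2 k : ℤ) : ℝ)| ≤ R := by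
  rw [Prod.norm_def, max_le_iff] at h
  refine ⟨fun a => ?_, fun k => ?_⟩
  · rw [← Int.norm_eq_abs]
    exact (norm_le_pi_norm (i - i').1 a).trans h.1
  · rw [← Int.norm_eq_abs]
    exact (norm_le_pi_norm (i - i').2 k).trans h.2

/-- On the span of independent vectors with integer data the form `waveForm` is nondegenerate,
and vectors with small products against the basis have a small component in the span. -/
theorem exists_waveForm_projection_span {κ : Type*} [Fintype κ] {ν d : ℕ} {R γ Θ : ℝ}
    (hR : ((d + 1).factorial : ℝ) + 2 * ν + 2 ≤ R) (hγ : 0 < γ) (hγR : 1 ≤ γ * R) (hΘ : Θ ≤ R)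
    {ω : Fin ν → ℝ} (hω : ∀ a, |ω a| ≤ 2) (hNR : QuadraticNonresonance γ ω)
    (f : κ → ℝ × (Fin d → ℝ)) (J : Matrix κ (Fin d) ℤ) (Lm : Matrix κ (Fin ν) ℤ)
    (hfJ : ∀ b, f b = (∑ a, ω a * (Lm b a : ℝ), fun k => (J b k : ℝ)))
    (hJ : ∀ b k, |(J b k : ℝ)| ≤ R) (hL : ∀ b a, |(Lm b a : ℝ)| ≤ R)
    (hli : LinearIndependent ℝ f) (z : ℝ × (Fin d → ℝ))
    (hz : ∀ b, |waveForm d (f b) (f b) + 2 * waveForm d (f b) z| ≤ 2 * Θ) :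
    (∀ w ∈ Submodule.span ℝ (Set.range f),
      (∀ w' ∈ Submodule.span ℝ (Set.range f), waveForm d w' w = 0) → w = 0) ∧
    ∃ v ∈ Submodule.span ℝ (Set.range f),
      (∀ w ∈ Submodule.span ℝ (Set.range f), waveForm d w (z - v) = 0) ∧
      ‖v.2‖ ≤ R ^ projExponent d ν := by
  classical
  have hfac : (1 : ℝ) ≤ ((d + 1).factorial : ℝ) := by
    exact_mod_cast Nat.one_le_iff_ne_zero.mpr (Nat.factorial_ne_zero _)
  have hν : (0 : ℝ) ≤ ν := Nat.cast_nonneg ν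
  have hR2 : 2 ≤ R := by linarith
  have hR0 : 0 ≤ R := by linarith
  have hR1 : 1 ≤ R := by linarith
  have hdR : ((d : ℝ) + 1) ≤ R := by
    have : ((d + 1 : ℕ) : ℝ) ≤ ((d + 1).factorial : ℝ) := by exact_mod_cast Nat.self_le_factorial _
    push_cast at this
    linarith
  have hcard : Fintype.card κ ≤ d + 1 := by
    rw [← finrank_prod_pi d]
    exact hli.fintype_card_le_finrank
  have hcardR : (Fintype.card κ : ℝ) ≤ R := by
    have : (Fintype.card κ : ℝ) ≤ ((d + 1 : ℕ) : ℝ) := by exact_mod_cast hcard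
    push_cast at this
    linarith
  have hdet := le_abs_det_gramMatrix hR hcard hγ hγR hNR J Lm hJ hL (by
    intro c h1 h2
    have := Fintype.linearIndependent_iff.mp hli c (by
      ext
      · simpa [hfJ, Prod.fst_sum] using h1
      · rename_i k
        simpa [hfJ, Prod.snd_sum] using h2 k)
    exact funext this)
  set D := gramMatrix (-1) J (fun b => ∑ a, ω a * (Lm b a : ℝ)) with hD
  have hDf : ∀ b b', D b b' = waveForm d (f b) (f b') := by
    intro b b'
    rw [hD, gramMatrix_apply, waveForm_apply, hfJ, hfJ]
    simp
  have hdet0 : D.det ≠ 0 := by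
    intro h
    rw [h] at hdet
    simp at hdet
    linarith
  have hform : ∀ (c : κ → ℝ) b, waveForm d (f b) (∑ b', c b' • f b') = D.mulVec c b := by
    intro c b
    simp [Matrix.mulVec, dotProduct, hDf, mul_comm]
  refine ⟨?_, ?_⟩
  · intro w hw h0
    obtain ⟨c, rfl⟩ := (Submodule.mem_span_range_iff_exists_fun ℝ).mp hw
    have h1 : D.mulVec c = 0 := by
      ext b
      rw [← hform]
      exact h0 _ (Submodule.subset_span ⟨b, rfl⟩)
    have h2 : c = 0 := Matrix.eq_zero_of_mulVec_eq_zero hdet0 h1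
    simp [h2]
  have hDle : ∀ b b', |D b b'| ≤ R ^ 5 :=
    abs_gramMatrix_le hR2 hdR (by linarith) hω J Lm hJ hL
  -- The coefficients c of the projection solve D c = y. The hypothesis `hz` gives |y b| ≤ Θ + R⁵/2,
  -- hence the bound R⁶.
  let y : κ → ℝ := fun b => waveForm d (f b) z
  have hy : ∀ b, |y b| ≤ R ^ 6 := by
    intro b
    have h3 : |D b b + 2 * y b| ≤ 2 * Θ := by rw [hDf]; exact hz b
    have h4 := abs_le.mp h3
    have h5 := abs_le.mp (hDle b b)
    have h6 : R ≤ R ^ 5 := le_self_pow₀ hR1 (by norm_num)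
    have h7 : R ^ 5 * 2 ≤ R ^ 6 := by
      rw [pow_succ R 5]; gcongr
    rw [abs_le]
    constructor <;> linarith [h4.1, h4.2, h5.1, h5.2]
  set T := (3 * d + 9) * (ν * (ν + 1)) + 2 with hT
  obtain ⟨c, hDc, hcb⟩ := exists_mulVec_eq_of_det (by linarith) hcard D hDle hdet y hy
  refine ⟨∑ b, c b • f b, Submodule.sum_mem _ fun b _ =>
    Submodule.smul_mem _ _ (Submodule.subset_span ⟨b, rfl⟩), ?_, ?_⟩
  · intro w hw
    induction hw using Submodule.span_induction with
    | mem w hw =>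
      obtain ⟨b, rfl⟩ := hw
      rw [map_sub, hform, hDc]
      exact sub_self _
    | zero => simp
    | add u v _ _ hu hv => rw [map_add, LinearMap.add_apply, hu, hv, add_zero]
    | smul t u _ hu => rw [map_smul, LinearMap.smul_apply, hu, smul_zero]
  · rw [pi_norm_le_iff_of_nonneg (by positivity)]
    intro k
    have h1 : (∑ b, c b • f b).2 k = ∑ b, c b * (J b k : ℝ) := by
      simp [Prod.snd_sum, hfJ]
    rw [h1, Real.norm_eq_abs]
    refine (abs_sum_le_of_le (A := R)
      (B := R ^ (T + 5 * d + 13) * R) _ hcardR (by positivity) ?_).trans ?_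
    · intro b
      rw [abs_mul]
      exact mul_le_mul (hcb b) (hJ _ _) (abs_nonneg _) (by positivity)
    · calc _ = R ^ (T + 5 * d + 15) := by ring
        _ ≤ R ^ projExponent d ν := by
          refine pow_le_pow_right₀ hR1 ?_
          simp only [projExponent, hT]
          omega

/-- On the span of the differences of a set of nearly isotropic site vectors the form `waveForm`
is nondegenerate, and the component of a site vector in this span is bounded by a power of the
size of the set. -/
theorem exists_waveForm_projection {ν d : ℕ} {R γ Θ : ℝ}
    (hR : ((d + 1).factorial : ℝ) + 2 * ν + 2 ≤ R) (hγ : 0 < γ) (hγR : 1 ≤ γ * R) (hΘ : Θ ≤ R)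
    {ω : Fin ν → ℝ} (hω : ∀ a, |ω a| ≤ 2) (hNR : QuadraticNonresonance γ ω) (θ : ℝ)
    (S : Set (Site ν d)) {i₀ : Site ν d} (hi₀ : i₀ ∈ S) (hS : ∀ i ∈ S, ‖i - i₀‖ ≤ R)
    (hQ : ∀ i ∈ S, |waveForm d (siteVec ω θ i) (siteVec ω θ i) -
      waveForm d (siteVec ω θ i₀) (siteVec ω θ i₀)| ≤ 2 * Θ) :
    (∀ w ∈ vectorSpan ℝ (siteVec ω θ '' S),
      (∀ w' ∈ vectorSpan ℝ (siteVec ω θ '' S), waveForm d w' w = 0) → w = 0) ∧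
    ∃ v ∈ vectorSpan ℝ (siteVec ω θ '' S),
      (∀ w ∈ vectorSpan ℝ (siteVec ω θ '' S), waveForm d w (siteVec ω θ i₀ - v) = 0) ∧
      ‖v.2‖ ≤ R ^ projExponent d ν := by
  have hG : vectorSpan ℝ (siteVec ω θ '' S) =
      Submodule.span ℝ (Set.range fun i : S => siteVec ω θ i - siteVec ω θ i₀) := by
    rw [vectorSpan_eq_span_vsub_set_right ℝ (Set.mem_image_of_mem _ hi₀), Set.image_image]
    congr 1
    ext w
    simp [Set.mem_image]
  -- The basis is chosen among the differences themselves, so that its data are integers bounded by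
  -- R; θ cancels in them.
  obtain ⟨κ, s, -, hspan, hli⟩ :=
    exists_linearIndependent' ℝ (fun i : S => siteVec ω θ i - siteVec ω θ i₀)
  rw [hG, ← hspan]
  have : Finite κ := hli.finite
  have : Fintype κ := Fintype.ofFinite κ
  have hd := fun b => abs_intCast_sub_le_of_norm_le (hS (s b) (s b).2)
  refine exists_waveForm_projection_span hR hγ hγR hΘ hω hNR _
    (Matrix.of fun b k => (s b).1.2 k - i₀.2 k) (Matrix.of fun b a => (s b).1.1 a - i₀.1 a)
    (fun b => ?_) (fun b k => ?_) (fun b a => ?_) hli (siteVec ω θ i₀) (fun b => ?_)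
  · simp only [Function.comp_apply, Matrix.of_apply]
    exact siteVec_sub ω θ (s b).1 i₀
  · simp only [Matrix.of_apply]
    exact (hd b).2 k
  · simp only [Matrix.of_apply]
    exact (hd b).1 a
  · have h := hQ (s b) (s b).2
    simp only [Function.comp_apply]
    rw [waveForm_self_sub] at h
    exact h

/-! ### Chains of nearly isotropic sites -/

theorem norm_sub_le_of_chain {E : Type*} [SeminormedAddCommGroup E] {z : ℕ → E} {L : ℕ} {Γ : ℝ}
    (hz : ∀ q < L, ‖z (q + 1) - z q‖ ≤ Γ) {p q : ℕ} (hpq : p ≤ q) (hq : q ≤ L) :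
    ‖z q - z p‖ ≤ ((q - p : ℕ) : ℝ) * Γ := by
  rw [← dist_eq_norm, dist_comm]
  refine (dist_le_Ico_sum_of_dist_le hpq (d := fun _ => Γ) fun {k} _ hk => ?_).trans (by simp)
  rw [dist_comm, dist_eq_norm]
  exact hz k (by omega)

/-- If all site vectors have bounded components in the span of their differences, the form being
nondegenerate there, then their space frequencies are close to each other. -/
theorem norm_snd_sub_le_of_projections {ν d : ℕ} {ω : Fin ν → ℝ} {θ B : ℝ} {S : Set (Site ν d)}
    (hnd : ∀ w ∈ vectorSpan ℝ (siteVec ω θ '' S),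
      (∀ w' ∈ vectorSpan ℝ (siteVec ω θ '' S), waveForm d w' w = 0) → w = 0)
    (hproj : ∀ i ∈ S, ∃ v ∈ vectorSpan ℝ (siteVec ω θ '' S),
      (∀ w ∈ vectorSpan ℝ (siteVec ω θ '' S), waveForm d w (siteVec ω θ i - v) = 0) ∧ ‖v.2‖ ≤ B)
    {i i' : Site ν d} (hi : i ∈ S) (hi' : i' ∈ S) : ‖i.2 - i'.2‖ ≤ 2 * B := by
  obtain ⟨v, hv, hvo, hvB⟩ := hproj i hi
  obtain ⟨v', hv', hvo', hvB'⟩ := hproj i' hi'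
  have hmem : siteVec ω θ i - siteVec ω θ i' ∈ vectorSpan ℝ (siteVec ω θ '' S) :=
    vsub_mem_vectorSpan ℝ (Set.mem_image_of_mem _ hi) (Set.mem_image_of_mem _ hi')
  -- The difference of site vectors minus the difference of projections lies in the span and is
  -- orthogonal to it, hence vanishes.
  have h0 := hnd ((siteVec ω θ i - siteVec ω θ i') - (v - v'))
    (Submodule.sub_mem _ hmem (Submodule.sub_mem _ hv hv')) (fun w hw => by
      have h1 := hvo w hw
      have h2 := hvo' w hw
      simp only [map_sub] at h1 h2 ⊢
      linarith)
  have h1 : (siteVec ω θ i - siteVec ω θ i').2 = v.2 - v'.2 := by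
    rw [sub_eq_zero.mp h0]; rfl
  have h2 : ‖i.2 - i'.2‖ ≤ ‖(siteVec ω θ i - siteVec ω θ i').2‖ := by
    refine (pi_norm_le_iff_of_nonneg (norm_nonneg _)).mpr fun k => ?_
    have h3 := norm_le_pi_norm (siteVec ω θ i - siteVec ω θ i').2 k
    rw [siteVec_sub] at h3 ⊢
    exact h3
  rw [h1] at h2
  exact (h2.trans (norm_sub_le _ _)).trans (by linarith)

/-- Pigeonhole: the values lie in a cube with (2M + 1)^d lattice points, each taken at most K times.
-/
theorem card_le_mul_of_fibers {d : ℕ} {J : ℕ → Fin d → ℤ} {n K M : ℕ}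
    (hK : ∀ j, ((Finset.range n).filter fun q => J q = j).card ≤ K)
    (hM : ∀ q < n, ‖J q - J 0‖ ≤ M) : n ≤ K * (2 * M + 1) ^ d := by
  have h1 := Finset.card_le_mul_card_image (f := J) (Finset.range n) K fun j _ => hK j
  rw [Finset.card_range] at h1
  refine h1.trans (Nat.mul_le_mul_left _ ?_)
  have h2 : (Finset.range n).image J ⊆
      Finset.Icc (fun a => J 0 a - (M : ℤ)) (fun a => J 0 a + (M : ℤ)) := by
    intro j hj
    obtain ⟨q, hq, rfl⟩ := Finset.mem_image.mp hj
    have h3 := hM q (Finset.mem_range.mp hq)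
    rw [pi_norm_le_iff_of_nonneg (by positivity)] at h3
    have h4 : ∀ a, J 0 a - (M : ℤ) ≤ J q a ∧ J q a ≤ J 0 a + (M : ℤ) := by
      intro a
      have h5 := h3 a
      rw [Pi.sub_apply, Int.norm_eq_abs] at h5
      have h6 : |J q a - J 0 a| ≤ (M : ℤ) := by exact_mod_cast h5
      rw [abs_le] at h6
      constructor <;> linarith [h6.1, h6.2]
    exact Finset.mem_Icc.mpr ⟨fun a => (h4 a).1, fun a => (h4 a).2⟩
  refine (Finset.card_le_card h2).trans ?_
  rw [Pi.card_Icc]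
  simp only [Int.card_Icc]
  have h7 : ∀ a, (J 0 a + (M : ℤ) + 1 - (J 0 a - (M : ℤ))).toNat = 2 * M + 1 := fun a => by omega
  simp [h7]

/-- Chains of nearly isotropic sites, with a polynomial bound on the number of sites having the
same space frequency, have polynomially bounded length. -/
theorem exists_chain_length_le (d ν k g : ℕ) :
    ∃ b : ℕ, ∀ N : ℕ, (d + 1).factorial + 2 * ν + 5 ≤ N →
      ∀ γ Θ : ℝ, 0 < γ → 1 ≤ γ * N → Θ ≤ N →
      ∀ ω : Fin ν → ℝ, (∀ a, |ω a| ≤ 2) → QuadraticNonresonance γ ω → ∀ θ : ℝ,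
      ∀ (z : ℕ → Site ν d) (L : ℕ), (∀ q < L, ‖z (q + 1) - z q‖ ≤ (N : ℝ) ^ 2) →
      (∀ p ≤ L, ∀ q ≤ L, |waveForm d (siteVec ω θ (z p)) (siteVec ω θ (z p)) -
        waveForm d (siteVec ω θ (z q)) (siteVec ω θ (z q))| ≤ 2 * Θ) →
      (∀ j, ((Finset.range (L + 1)).filter fun q => (z q).2 = j).card ≤ N ^ k) →
      Module.finrank ℝ (vectorSpan ℝ (siteVec ω θ '' (z '' Set.Iic L))) ≤ g →
      L ≤ N ^ b := by
  induction g with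
  | zero =>
    refine ⟨k, ?_⟩
    intro N hN γ Θ hγ hγN hΘ ω hω hNR θ z L hz hQ hK hg
    -- In dimension zero all site vectors coincide, so the whole chain lies over a single j.
    have h0 : vectorSpan ℝ (siteVec ω θ '' (z '' Set.Iic L)) = ⊥ :=
      Submodule.finrank_eq_zero.mp (Nat.le_zero.mp hg)
    have h1 := card_le_mul_of_fibers (J := fun q => (z q).2) (M := 0) hK (fun q hq => by
      have := norm_snd_sub_le_of_projections (B := 0) (S := z '' Set.Iic L) (ω := ω) (θ := θ)
        (fun w hw _ => by rw [h0] at hw; exact hw)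
        (fun i _ => ⟨0, Submodule.zero_mem _, fun w hw => by
          rw [h0] at hw; rw [(Submodule.mem_bot ℝ).mp hw]; simp, by simp⟩)
        (Set.mem_image_of_mem z (show q ∈ Set.Iic L by simp; omega))
        (Set.mem_image_of_mem z (show 0 ∈ Set.Iic L by simp))
      simpa using this)
    simp at h1
    omega
  | succ g ih =>
    obtain ⟨b, hb⟩ := ih
    set e := projExponent d ν with he
    -- The summand b + 1 covers chains no longer than a window. Otherwise a window has diameter at
    -- most R = N^(b+3), projections are at most R^e, the j's lie in a cube of side at most
    -- N^((b+3)e+1), and each j is taken at most N^k times.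
    refine ⟨(b + 1) + (k + ((b + 3) * e + 1) * d), ?_⟩
    intro N hN γ Θ hγ hγN hΘ ω hω hNR θ z L hz hQ hK hg
    have hN1 : 1 ≤ N := by omega
    -- One more than the inductive bound: a window of `L₀` steps cannot have rank at most g.
    set L₀ := N ^ b + 1 with hL₀
    have hpb : 1 ≤ N ^ b := Nat.one_le_pow _ _ hN1
    have hL₀N : L₀ ≤ N ^ (b + 1) := by
      rw [pow_succ]
      nlinarith
    rcases le_or_gt L L₀ with hL | hL
    · exact (hL.trans hL₀N).trans (Nat.pow_le_pow_right hN1 (by omega))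
    set G := vectorSpan ℝ (siteVec ω θ '' (z '' Set.Iic L)) with hG
    set R : ℝ := (N : ℝ) ^ (b + 3) with hR
    have hN1' : (1 : ℝ) ≤ N := by exact_mod_cast hN1
    have hNR' : (N : ℝ) ≤ R := le_self_pow₀ hN1' (by omega)
    have hRc : ((d + 1).factorial : ℝ) + 2 * ν + 2 ≤ R := by
      have : (((d + 1).factorial + 2 * ν + 5 : ℕ) : ℝ) ≤ N := by exact_mod_cast hN
      push_cast at this
      linarith
    have hwin : ∀ q ≤ L, (∀ w ∈ G, (∀ w' ∈ G, waveForm d w' w = 0) → w = 0) ∧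
        ∃ v ∈ G, (∀ w ∈ G, waveForm d w (siteVec ω θ (z q) - v) = 0) ∧ ‖v.2‖ ≤ R ^ e := by
      intro q hq
      -- Start of a window of `L₀` steps that contains q and does not leave [0, L].
      set a := min q (L - L₀) with ha
      set S : Set (Site ν d) := (fun n => z (a + n)) '' Set.Iic L₀ with hS
      have hSsub : S ⊆ z '' Set.Iic L := by
        rintro _ ⟨n, hn, rfl⟩
        refine Set.mem_image_of_mem z ?_
        simp only [Set.mem_Iic] at hn ⊢
        omega
      have hle : vectorSpan ℝ (siteVec ω θ '' S) ≤ G :=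
        vectorSpan_mono ℝ (Set.image_mono hSsub)
      have hfr : ¬ Module.finrank ℝ (vectorSpan ℝ (siteVec ω θ '' S)) ≤ g := by
        intro hcon
        have := hb N hN γ Θ hγ hγN hΘ ω hω hNR θ (fun n => z (a + n)) L₀
          (fun p hp => hz (a + p) (by omega))
          (fun p hp p' hp' => hQ (a + p) (by omega) (a + p') (by omega))
          (fun j => by
            refine le_trans ?_ (hK j)
            refine Finset.card_le_card_of_injOn (fun n => a + n) ?_ ?_
            · intro n hn
              simp only [Finset.coe_filter, Finset.mem_range, Set.mem_ofPred_eq] at hn ⊢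
              exact ⟨by omega, hn.2⟩
            · intro n _ n' _ h
              simpa using h) hcon
        omega
      -- The window has rank at least g + 1 and the chain at most g + 1. All windows therefore span
      -- the same G, which makes their projections comparable.
      have heq : vectorSpan ℝ (siteVec ω θ '' S) = G :=
        Submodule.eq_of_le_of_finrank_le hle (by omega)
      rw [← heq]
      refine exists_waveForm_projection hRc hγ
        (hγN.trans (by gcongr)) (hΘ.trans hNR') hω hNR θ S ?_ ?_ ?_
      · refine ⟨q - a, ?_, ?_⟩
        · simp only [Set.mem_Iic]; omega
        · simp only; congr 1; omega
      · rintro _ ⟨n, hn, rfl⟩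
        simp only [Set.mem_Iic] at hn
        have hbd : ∀ m : ℕ, m ≤ L₀ → (m : ℝ) * (N : ℝ) ^ 2 ≤ R := by
          intro m hm
          have : (m : ℝ) ≤ (N : ℝ) ^ (b + 1) := by exact_mod_cast hm.trans hL₀N
          calc (m : ℝ) * (N : ℝ) ^ 2 ≤ (N : ℝ) ^ (b + 1) * (N : ℝ) ^ 2 := by gcongr
            _ = R := by rw [hR]; ring
        rcases le_total q (a + n) with h | h
        · exact (norm_sub_le_of_chain hz h (by omega)).trans (hbd _ (by omega))
        · rw [norm_sub_rev]
          exact (norm_sub_le_of_chain hz h hq).trans (hbd _ (by omega))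
      · rintro _ ⟨n, hn, rfl⟩
        simp only [Set.mem_Iic] at hn
        exact hQ (a + n) (by omega) q hq
    have hJ : ∀ q < L + 1, ‖(z q).2 - (z 0).2‖ ≤ ((2 * N ^ ((b + 3) * e) : ℕ) : ℝ) := by
      intro q hq
      have h1 := norm_snd_sub_le_of_projections (B := R ^ e) (S := z '' Set.Iic L)
        (ω := ω) (θ := θ) (hwin 0 (by omega)).1
        (by
          rintro _ ⟨p, hp, rfl⟩
          exact (hwin p hp).2)
        (Set.mem_image_of_mem z (show q ∈ Set.Iic L by simp; omega))
        (Set.mem_image_of_mem z (show 0 ∈ Set.Iic L by simp))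
      refine h1.trans (le_of_eq ?_)
      push_cast
      rw [hR, ← pow_mul]
    have h2 := card_le_mul_of_fibers hK hJ
    have h3 : 2 * (2 * N ^ ((b + 3) * e)) + 1 ≤ N ^ ((b + 3) * e + 1) := by
      have : 1 ≤ N ^ ((b + 3) * e) := Nat.one_le_pow _ _ hN1
      rw [pow_succ]
      nlinarith
    calc L ≤ N ^ k * (2 * (2 * N ^ ((b + 3) * e)) + 1) ^ d := by omega
      _ ≤ N ^ k * (N ^ ((b + 3) * e + 1)) ^ d := by gcongr
      _ = N ^ (k + ((b + 3) * e + 1) * d) := by rw [← pow_mul, ← pow_add]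
      _ ≤ _ := Nat.pow_le_pow_right hN1 (by omega)

/-! ### Translation covariance and the diagonal of the matrix -/

theorem diagSup_submatrix {ν d : ℕ} {E E' : Finset (Site ν d)} (σ : E' ≃ E) (t : Site ν d)
    (hσ : ∀ e, (σ e : Site ν d) = e + t) (M : Matrix E E ℂ) (n : Site ν d) :
    diagSup (M.submatrix σ σ) n = diagSup M n := by
  refine Equiv.iSup_congr ((Equiv.prodCongr σ σ).subtypeEquiv fun p => ?_) fun p => rfl
  simp [hσ]

theorem sNorm_submatrix {ν d : ℕ} (K₀ s : ℝ) {E E' : Finset (Site ν d)} (σ : E' ≃ E)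
    (t : Site ν d) (hσ : ∀ e, (σ e : Site ν d) = e + t) (M : Matrix E E ℂ) :
    sNorm K₀ s (M.submatrix σ σ) = sNorm K₀ s M := by
  have himg : (E' ×ˢ E').image (fun p => p.1 - p.2) = (E ×ˢ E).image (fun p => p.1 - p.2) := by
    ext n
    simp only [Finset.mem_image, Finset.mem_product]
    constructor
    · rintro ⟨⟨a, b⟩, ⟨ha, hb⟩, rfl⟩
      exact ⟨(σ ⟨a, ha⟩, σ ⟨b, hb⟩), ⟨(σ ⟨a, ha⟩).2, (σ ⟨b, hb⟩).2⟩, by simp [hσ]⟩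
    · rintro ⟨⟨a, b⟩, ⟨ha, hb⟩, rfl⟩
      refine ⟨(σ.symm ⟨a, ha⟩, σ.symm ⟨b, hb⟩),
        ⟨(σ.symm ⟨a, ha⟩).2, (σ.symm ⟨b, hb⟩).2⟩, ?_⟩
      have h1 := hσ (σ.symm ⟨a, ha⟩)
      have h2 := hσ (σ.symm ⟨b, hb⟩)
      simp only [Equiv.apply_symm_apply] at h1 h2
      simp only
      rw [eq_sub_of_add_eq h1.symm, eq_sub_of_add_eq h2.symm]
      abel
  simp only [sNorm, himg, diagSup_submatrix σ t hσ]

/-- Goodness of a matrix is invariant under translations of the index set. -/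
theorem isGoodMatrix_submatrix_iff {ν d : ℕ} (c : GoodConstants) (N : ℕ)
    {E E' : Finset (Site ν d)} (σ : E' ≃ E) (t : Site ν d)
    (hσ : ∀ e, (σ e : Site ν d) = e + t) (M : Matrix E E ℂ) :
    IsGoodMatrix c N (M.submatrix σ σ) ↔ IsGoodMatrix c N M := by
  simp only [IsGoodMatrix, Matrix.isUnit_submatrix_equiv, Matrix.inv_submatrix_equiv,
    sNorm_submatrix _ _ σ t hσ]

/-- Translating the time frequencies amounts to translating `θ`. -/
theorem siteMatrix_add_time {ν d : ℕ} (ωbar : Fin ν → ℝ) (V : (Fin d → ℝ) → ℝ)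
    (f : (Fin ν → ℝ) → (Fin d → ℝ) → ℝ → ℝ) (u : (Fin ν → ℝ) → (Fin d → ℝ) → ℝ)
    (ε lam θ : ℝ) (l : Fin ν → ℤ) (i i' : Site ν d) :
    siteMatrix ωbar V f u ε lam θ (i + (l, 0)) (i' + (l, 0)) =
      siteMatrix ωbar V f u ε lam (θ + ∑ a, lam * ωbar a * (l a : ℝ)) i i' := by
  have h : lam * (∑ a, ωbar a * (((i.1 a + l a : ℤ)) : ℝ)) + θ =
      lam * (∑ a, ωbar a * (i.1 a : ℝ)) + (θ + ∑ a, lam * ωbar a * (l a : ℝ)) := by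
    push_cast
    simp only [mul_add, Finset.sum_add_distrib, Finset.mul_sum, mul_assoc]
    ring
  simp only [siteMatrix, Matrix.add_apply, Matrix.diagonal_apply, Matrix.of_apply,
    add_left_inj, Prod.fst_add, Prod.snd_add, add_zero, add_sub_add_right_eq_sub, Pi.add_apply,
    Pi.zero_apply, h]

/-- Moving the box from (l, j) to (0, j) replaces θ by θ + ω·l, so that the covering of the bad set
of θ applies to boxes at any l. -/
theorem isRegularSite_iff_notMem_badTheta {ν d : ℕ} (c : GoodConstants) (ωbar : Fin ν → ℝ)
    (V : (Fin d → ℝ) → ℝ) (f : (Fin ν → ℝ) → (Fin d → ℝ) → ℝ → ℝ)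
    (u : (Fin ν → ℝ) → (Fin d → ℝ) → ℝ) (ε lam θ : ℝ) (M : ℕ) (i : Site ν d) :
    IsRegularSite c (siteMatrix ωbar V f u ε lam θ) M i ↔
      θ + ∑ a, lam * ωbar a * (i.1 a : ℝ) ∉
        badTheta c (fun θ => siteMatrix ωbar V f u ε lam θ) M i.2 := by
  have hmem : ∀ e : Site ν d, e ∈ siteBox M ((0, i.2) : Site ν d) ↔
      Equiv.addRight ((i.1, 0) : Site ν d) e ∈ siteBox M i := by
    intro e
    rw [mem_siteBox, mem_siteBox]
    have : Equiv.addRight ((i.1, 0) : Site ν d) e - i = e - (0, i.2) := by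
      ext <;> simp
    rw [this]
  let σ : siteBox M ((0, i.2) : Site ν d) ≃ siteBox M i :=
    (Equiv.addRight ((i.1, 0) : Site ν d)).subtypeEquiv hmem
  have h := isGoodMatrix_submatrix_iff c M σ (i.1, 0) (fun _ => rfl)
    (subBox (siteMatrix ωbar V f u ε lam θ) M i)
  have h2 : (subBox (siteMatrix ωbar V f u ε lam θ) M i).submatrix σ σ =
      subBox (siteMatrix ωbar V f u ε lam (θ + ∑ a, lam * ωbar a * (i.1 a : ℝ))) M (0, i.2) := by
    ext e e'
    exact siteMatrix_add_time ωbar V f u ε lam θ i.1 e e'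
  rw [h2] at h
  simp only [IsRegularSite, badTheta, Set.mem_ofPred_eq, not_not, h]

/-- The Toeplitz part contributes only its zeroth Fourier coefficients to the diagonal, and these do
not depend on the site. -/
theorem exists_siteMatrix_diag_eq {ν d : ℕ} (ωbar : Fin ν → ℝ) (V : (Fin d → ℝ) → ℝ)
    (f : (Fin ν → ℝ) → (Fin d → ℝ) → ℝ → ℝ) (u : (Fin ν → ℝ) → (Fin d → ℝ) → ℝ)
    (ε lam θ : ℝ) :
    ∃ C : ℂ, ∀ i : Site ν d, siteMatrix ωbar V f u ε lam θ i i =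
      ((waveForm d (siteVec (fun a => lam * ωbar a) θ i)
        (siteVec (fun a => lam * ωbar a) θ i) : ℝ) : ℂ) + C := by
  refine ⟨(torusMean V : ℂ) + (fourierSpace (fun x => V x - torusMean V) 0 -
    (ε : ℂ) * fourierSpaceTime (linearizedCoeff f u) 0), fun i => ?_⟩
  have h : lam * (∑ a, ωbar a * (i.1 a : ℝ)) = ∑ a, lam * ωbar a * (i.1 a : ℝ) := by
    simp only [Finset.mul_sum, mul_assoc]
  simp only [siteMatrix, Matrix.add_apply, Matrix.diagonal_apply_eq, Matrix.of_apply, if_true,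
    sub_self, waveForm_apply, siteVec, h]
  generalize fourierSpace _ 0 = F₀
  push_cast
  ring_nf

/-- Two sites at which the diagonal of the matrix is small have nearly equal values of the
quadratic form. -/
theorem abs_waveForm_sub_le_of_norm_diag_lt {ν d : ℕ} (ωbar : Fin ν → ℝ) (V : (Fin d → ℝ) → ℝ)
    (f : (Fin ν → ℝ) → (Fin d → ℝ) → ℝ → ℝ) (u : (Fin ν → ℝ) → (Fin d → ℝ) → ℝ)
    (ε lam θ : ℝ) {Θ : ℝ} {i i' : Site ν d} (hi : ‖siteMatrix ωbar V f u ε lam θ i i‖ < Θ)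
    (hi' : ‖siteMatrix ωbar V f u ε lam θ i' i'‖ < Θ) :
    |waveForm d (siteVec (fun a => lam * ωbar a) θ i) (siteVec (fun a => lam * ωbar a) θ i) -
      waveForm d (siteVec (fun a => lam * ωbar a) θ i') (siteVec (fun a => lam * ωbar a) θ i')| ≤
      2 * Θ := by
  obtain ⟨C, hC⟩ := exists_siteMatrix_diag_eq (d := d) ωbar V f u ε lam θ
  have h := norm_sub_le (siteMatrix ωbar V f u ε lam θ i i) (siteMatrix ωbar V f u ε lam θ i' i')
  rw [hC i, hC i', add_sub_add_right_eq_sub, ← Complex.ofReal_sub, Complex.norm_real,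
    Real.norm_eq_abs, ← hC i, ← hC i'] at h
  linarith

/-! ### Counting bad sites over a fixed space frequency -/

theorem abs_sub_le_of_ordConnected {I : Set ℝ} (hI : I.OrdConnected) {r : ℝ} (hr : 0 ≤ r)
    (hv : MeasureTheory.volume I ≤ ENNReal.ofReal r) {x y : ℝ} (hx : x ∈ I) (hy : y ∈ I) :
    |x - y| ≤ r := by
  have h := (MeasureTheory.measure_mono (μ := MeasureTheory.volume) (hI.uIcc_subset hy hx)).trans hv
  rw [Real.volume_interval] at h
  exact (ENNReal.ofReal_le_ofReal_iff hr).mp h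

/-- The number of bad sites with a given space frequency is polynomially bounded. -/
theorem card_badSites_fiber_le {ν d : ℕ} (c : GoodConstants) {Θ τ χ lam : ℝ} {L₀ N : ℕ}
    (hN : 2 * 3 ^ (d + ν) ≤ N) (hχ : 1 < χ)
    (ωbar : Fin ν → ℝ) (V : (Fin d → ℝ) → ℝ) (f : (Fin ν → ℝ) → (Fin d → ℝ) → ℝ → ℝ)
    (u : (Fin ν → ℝ) → (Fin d → ℝ) → ℝ) (ε θ : ℝ)
    (hsep : ∀ l : Fin ν → ℤ, l ≠ 0 → ‖l‖ ≤ 4 * (N : ℝ) ^ χ →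
      (N : ℝ) ^ (-τ) < |∑ a, lam * ωbar a * (l a : ℝ)|)
    (hgood : IsGoodFamily c τ L₀ (fun θ => siteMatrix ωbar V f u ε lam θ) N)
    (j : Fin d → ℤ) (F : Finset (Site ν d))
    (hF : ∀ i ∈ F, i ∈ badSites c Θ L₀ (siteMatrix ωbar V f u ε lam θ) N ((N : ℝ) ^ χ) ∧ i.2 = j) :
    F.card ≤ N ^ (3 * d + 2 * ν + 4) := by
  classical
  have hN1 : 1 ≤ N := le_trans (by
    have : 1 ≤ 3 ^ (d + ν) := Nat.one_le_pow _ _ (by norm_num)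
    omega) hN
  have hN1' : (1 : ℝ) ≤ N := by exact_mod_cast hN1
  have hNχ : (N : ℝ) ≤ (N : ℝ) ^ χ := by
    simpa using Real.rpow_le_rpow_of_exponent_le hN1' hχ.le
  let sz : Bool → ℕ := fun m => if m then N else N - 2 * L₀
  have hsz : ∀ m, sz m ≤ N := fun m => by
    simp only [sz]; split_ifs <;> omega
  -- Empty intervals serve as default values at exceptional j', so that the intervals can be chosen
  -- for all j' at once.
  have hI : ∀ (m : Bool) (j' : Fin d → ℤ), ∃ I : Fin (N ^ (2 * d + ν + 3)) → Set ℝ,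
      (∀ q, (I q).OrdConnected ∧
        MeasureTheory.volume (I q) ≤ ENNReal.ofReal ((N : ℝ) ^ (-τ))) ∧
      (j' ∉ exceptionalSites L₀ (sz m) →
        badTheta c (fun θ => siteMatrix ωbar V f u ε lam θ) (sz m) j' ⊆ ⋃ q, I q) := by
    intro m j'
    by_cases hj : j' ∈ exceptionalSites L₀ (sz m)
    · exact ⟨fun _ => ∅, fun _ => ⟨Set.ordConnected_empty, by simp⟩, fun h => absurd hj h⟩
    · obtain ⟨I, h1, h2⟩ := hgood (sz m) (by simp only [sz]; split_ifs <;> simp) j' hj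
      exact ⟨I, h1, fun _ => h2⟩
  choose I hIc hIsub using hI
  have hbad : ∀ i : F, ∃ (m : Bool) (i' : Site ν d) (q : Fin (N ^ (2 * d + ν + 3))),
      ‖i' - i‖ ≤ N ∧ θ + ∑ a, lam * ωbar a * (i'.1 a : ℝ) ∈ I m i'.2 q := by
    rintro ⟨i, hi⟩
    have hi := (hF i hi).1.1
    rw [IsGoodSite, not_or] at hi
    obtain ⟨-, hi⟩ := hi
    push Not at hi
    obtain ⟨M, hM, i', hi', hj', hreg⟩ := hi
    obtain ⟨m, rfl⟩ : ∃ m, M = sz m := by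
      rcases hM with rfl | hM
      · exact ⟨false, rfl⟩
      · exact ⟨true, hM⟩
    rw [isRegularSite_iff_notMem_badTheta, not_not] at hreg
    obtain ⟨q, hq⟩ := Set.mem_iUnion.mp (hIsub m i'.2 hj' hreg)
    exact ⟨m, i', q, hi'.trans (by exact_mod_cast hsz m), hq⟩
  choose m i' q hdist hmem using hbad
  have hdist' : ∀ i : F, ‖(i' i).1 - (i : Site ν d).1‖ ≤ N ∧ ‖(i' i).2 - (i : Site ν d).2‖ ≤ N :=
    fun i => by
      have := hdist i
      rw [Prod.norm_def, max_le_iff] at this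
      exact this
  have hcard : ∀ n : ℕ, (Finset.Icc (fun _ : Fin n => -(N : ℤ)) (fun _ => (N : ℤ))).card =
      (2 * N + 1) ^ n := by
    intro n
    have : ((N : ℤ) + 1 - -(N : ℤ)).toNat = 2 * N + 1 := by omega
    rw [Pi.card_Icc]
    simp only [Int.card_Icc, this]
    simp
  have hIcc : ∀ {n : ℕ} (x : Fin n → ℤ), ‖x‖ ≤ N →
      x ∈ Finset.Icc (fun _ : Fin n => -(N : ℤ)) (fun _ => (N : ℤ)) := by
    intro n x hx
    rw [pi_norm_le_iff_of_nonneg (by positivity)] at hx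
    have : ∀ a, |x a| ≤ (N : ℤ) := fun a => by
      have := hx a
      rw [Int.norm_eq_abs] at this
      exact_mod_cast this
    exact Finset.mem_Icc.mpr ⟨fun a => (abs_le.mp (this a)).1, fun a => (abs_le.mp (this a)).2⟩
  let T : Finset (Bool × Fin (N ^ (2 * d + ν + 3)) × (Fin d → ℤ) × (Fin ν → ℤ)) :=
    Finset.univ ×ˢ Finset.univ ×ˢ
      Finset.Icc (fun _ : Fin d => -(N : ℤ)) (fun _ => (N : ℤ)) ×ˢ
      Finset.Icc (fun _ : Fin ν => -(N : ℤ)) (fun _ => (N : ℤ))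
  -- A bad site over j is encoded by the box size, the interval, and the displacement to the centre
  -- of a bad box nearby.
  have hle : (Finset.univ : Finset F).card ≤ T.card := by
    refine Finset.card_le_card_of_injOn
      (fun i => (m i, q i, (i' i).2 - (i : Site ν d).2, (i' i).1 - (i : Site ν d).1)) ?_ ?_
    · intro i _
      simp only [T, Finset.coe_product, Set.mem_prod, Finset.coe_univ, Set.mem_univ, true_and,
        Finset.mem_coe]
      exact ⟨hIcc _ (hdist' i).2, hIcc _ (hdist' i).1⟩
    · intro x _ y _ hxy
      simp only [Prod.mk.injEq] at hxy
      obtain ⟨hm, hq, h2, h1⟩ := hxy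
      have hxj := (hF x x.2).2
      have hyj := (hF y y.2).2
      rw [hxj, hyj, sub_left_inj] at h2
      have hx := hmem x
      have hy := hmem y
      rw [hm, hq, h2] at hx
      have hdiff := abs_sub_le_of_ordConnected (hIc _ _ _).1 (by positivity) (hIc _ _ _).2 hx hy
      -- Equal codes put both values θ + ω·l' in one interval. Since |l'| ≤ N^χ + N ≤ 2N^χ, distinct
      -- l' would differ by at most 4N^χ and be separated by `hsep`.
      have hl : (i' x).1 = (i' y).1 := by
        by_contra hne
        have hnorm : ∀ z : F, ‖(i' z).1‖ ≤ 2 * (N : ℝ) ^ χ := fun z => by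
          have h3 : ‖(z : Site ν d).1‖ ≤ (N : ℝ) ^ χ := (hF z z.2).1.2
          have h4 : ‖(i' z).1‖ ≤ ‖(i' z).1 - (z : Site ν d).1‖ + ‖(z : Site ν d).1‖ := by
            simpa using norm_add_le ((i' z).1 - (z : Site ν d).1) (z : Site ν d).1
          linarith [(hdist' z).1]
        have h5 := hsep ((i' x).1 - (i' y).1) (sub_ne_zero.mpr hne)
          ((norm_sub_le _ _).trans (by linarith [hnorm x, hnorm y]))
        have h6 : ∑ a, lam * ωbar a * ((((i' x).1 - (i' y).1) a : ℤ) : ℝ) =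
            (θ + ∑ a, lam * ωbar a * ((i' x).1 a : ℝ)) -
              (θ + ∑ a, lam * ωbar a * ((i' y).1 a : ℝ)) := by
          simp [mul_sub, Finset.sum_sub_distrib]
        rw [h6] at h5
        linarith
      rw [hl, sub_right_inj] at h1
      exact Subtype.ext (Prod.ext h1 (hxj.trans hyj.symm))
  rw [Finset.card_univ, Fintype.card_coe] at hle
  refine hle.trans ?_
  simp only [T, Finset.card_product, Finset.card_univ, Fintype.card_bool, Fintype.card_fin, hcard]
  calc 2 * (N ^ (2 * d + ν + 3) * ((2 * N + 1) ^ d * (2 * N + 1) ^ ν))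
      ≤ 2 * (N ^ (2 * d + ν + 3) * ((3 * N) ^ d * (3 * N) ^ ν)) := by gcongr <;> omega
    _ = (2 * 3 ^ (d + ν)) * N ^ (3 * d + 2 * ν + 3) := by rw [mul_pow, mul_pow]; ring
    _ ≤ N * N ^ (3 * d + 2 * ν + 3) := by gcongr
    _ = N ^ (3 * d + 2 * ν + 4) := by ring

/-! ### Clusters as connected components, and the conclusion -/

/-- If chains with steps at most `ρ` have extent at most `D`, then the connected components for
the relation of being at distance at most `ρ` form a separated partition. -/
theorem exists_isSeparatedPartition {ν d : ℕ} (S : Set (Site ν d)) {D ρ : ℝ}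
    (h : ∀ (z : ℕ → Site ν d) (L : ℕ), (∀ q, z q ∈ S) → Set.InjOn z (Set.Iic L) →
      (∀ q < L, ‖z (q + 1) - z q‖ ≤ ρ) → ‖z L - z 0‖ ≤ D) :
    ∃ P : Set (Set (Site ν d)), IsSeparatedPartition S D ρ P := by
  let G : SimpleGraph S :=
    { Adj := fun x y => x ≠ y ∧ ‖(x : Site ν d) - y‖ ≤ ρ
      symm := ⟨fun x y hxy => ⟨hxy.1.symm, by rw [norm_sub_rev]; exact hxy.2⟩⟩
      loopless := ⟨fun x hx => hx.1 rfl⟩ }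
  let cl : G.ConnectedComponent → Set (Site ν d) := fun C => Subtype.val '' C.supp
  have hdisj : ∀ C C' : G.ConnectedComponent, cl C ≠ cl C' → ∀ x : S, ∀ y : S,
      G.connectedComponentMk x = C → G.connectedComponentMk y = C' → ¬ G.Reachable x y := by
    rintro C C' hne x y rfl rfl hr
    exact hne (by rw [SimpleGraph.ConnectedComponent.eq.mpr hr])
  refine ⟨Set.range cl, ?_, ?_, ?_, ?_, ?_⟩
  · rintro _ ⟨C, rfl⟩
    exact C.nonempty_supp.image _
  · rintro _ ⟨C, rfl⟩ _ ⟨C', rfl⟩ hne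
    rw [Function.onFun, id, id, Set.disjoint_left]
    rintro _ ⟨x, hx, rfl⟩ ⟨y, hy, hxy⟩
    obtain rfl : y = x := Subtype.ext hxy
    exact hdisj C C' hne y y hx hy (SimpleGraph.Reachable.refl y)
  · ext i
    constructor
    · rintro ⟨_, ⟨C, rfl⟩, x, -, rfl⟩
      exact x.2
    · intro hi
      exact ⟨_, ⟨G.connectedComponentMk ⟨i, hi⟩, rfl⟩, ⟨i, hi⟩, rfl, rfl⟩
  · rintro _ ⟨C, rfl⟩ _ ⟨x, hx, rfl⟩ _ ⟨y, hy, rfl⟩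
    have hr : G.Reachable y x :=
      SimpleGraph.ConnectedComponent.exact ((show _ = C from hy).trans (show _ = C from hx).symm)
    -- A path rather than a walk: the fibre count bounds sites, not repeated visits. Beyond its
    -- length `getVert` stays at the endpoint, so the sequence remains in S but is injective only up
    -- to the length.
    obtain ⟨p, hp⟩ := hr.exists_isPath
    have := h (fun q => (p.getVert q : Site ν d)) p.length (fun q => (p.getVert q).2)
      (fun a ha b hb hab => hp.getVert_injOn ha hb (Subtype.ext hab))
      (fun q hq => by
        rw [norm_sub_rev]
        exact (p.adj_getVert_succ hq).2)
    simpa using this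
  · rintro _ ⟨C, rfl⟩ _ ⟨C', rfl⟩ hne _ ⟨x, hx, rfl⟩ _ ⟨y, hy, rfl⟩
    by_contra! hle
    refine hdisj C C' hne x y hx hy ?_
    by_cases hxy : x = y
    · exact hxy ▸ SimpleGraph.Reachable.refl x
    · exact SimpleGraph.Adj.reachable (show G.Adj x y from ⟨hxy, hle⟩)

/-- For `N` large, `λ ω̄·l` is larger than `N^{-τ}` for `0 < |l| ≤ 4 N^χ`, when `χ ν < τ`. -/
theorem eventually_lt_abs_of_isDiophantine (ν : ℕ) {γ₀ τ χ : ℝ} (hγ₀ : 0 < γ₀)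
    (hτ : χ * (ν : ℝ) < τ) :
    ∀ᶠ N : ℕ in Filter.atTop, ∀ ωbar : Fin ν → ℝ, IsDiophantine γ₀ ωbar →
      ∀ lam ∈ Set.Icc (1 / 2 : ℝ) (3 / 2), ∀ l : Fin ν → ℤ, l ≠ 0 → ‖l‖ ≤ 4 * (N : ℝ) ^ χ →
        (N : ℝ) ^ (-τ) < |∑ a, lam * ωbar a * (l a : ℝ)| := by
  have ht : Filter.Tendsto (fun N : ℕ => (N : ℝ) ^ (-(τ - χ * ν))) Filter.atTop (nhds 0) :=
    (tendsto_rpow_neg_atTop (sub_pos.mpr hτ)).comp tendsto_natCast_atTop_atTop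
  have hc : 0 < γ₀ / 4 ^ ν := by positivity
  filter_upwards [ht.eventually_lt_const hc, Filter.eventually_ge_atTop 1]
    with N hN hN1 ωbar hω lam hlam l hl hnorm
  have hN0 : (0 : ℝ) < N := by exact_mod_cast hN1
  have hl0 : 0 < ‖l‖ := norm_pos_iff.mpr hl
  have h1 := hω l hl
  have e : ∑ a, lam * ωbar a * (l a : ℝ) = lam * ∑ a, ωbar a * (l a : ℝ) := by
    simp only [Finset.mul_sum, mul_assoc]
  have hlam0 : 0 < lam := by linarith [hlam.1]
  rw [e, abs_mul, abs_of_pos hlam0]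
  -- The second factor matches the Diophantine loss at |l| ≤ 4N^χ; the first tends to zero because
  -- χν < τ and absorbs γ₀ / 4^ν.
  have h2 : (N : ℝ) ^ (-τ) = (N : ℝ) ^ (-(τ - χ * ν)) * ((N : ℝ) ^ (χ * ν))⁻¹ := by
    rw [← Real.rpow_neg hN0.le, ← Real.rpow_add hN0]
    congr 1
    ring
  have h3 : ‖l‖ ^ ν ≤ 4 ^ ν * (N : ℝ) ^ (χ * ν) := by
    rw [Real.rpow_mul_natCast hN0.le, ← mul_pow]
    gcongr
  calc (N : ℝ) ^ (-τ) < γ₀ / 4 ^ ν * ((N : ℝ) ^ (χ * ν))⁻¹ := by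
        rw [h2]; gcongr
    _ = γ₀ / (4 ^ ν * (N : ℝ) ^ (χ * ν)) := by
        rw [← div_eq_mul_inv, div_div]
    _ ≤ γ₀ / ‖l‖ ^ ν := by gcongr
    _ = 1 / 2 * (2 * γ₀ / ‖l‖ ^ ν) := by ring
    _ ≤ lam * |∑ a, ωbar a * (l a : ℝ)| := by
        gcongr
        exact hlam.1

theorem mainTheorem3 (d ν : ℕ) (hd : 1 ≤ d) (hν : 1 ≤ ν) :
    ∃ C₁ : ℝ, 2 ≤ C₁ ∧
      ∀ γ₀ Θ γ τ χ : ℝ, 0 < γ₀ → γ₀ < 1 → 1 ≤ Θ → 0 < γ → 1 < χ → χ * (ν : ℝ) < τ →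
        ∃ N₀ : ℕ, ∀ N : ℕ, N₀ ≤ N →
          ∀ L₀ : ℕ, (N : ℝ) / 2 ≤ (N : ℝ) - 2 * (L₀ : ℝ) →
          ∀ c : GoodConstants, 0 < c.K₀ → ((d : ℝ) + (ν : ℝ)) / 2 < c.s₀ → c.s₀ ≤ c.s₁ →
            0 < c.δ → c.δ < 1 →
          ∀ ωbar : Fin ν → ℝ, ‖ωbar‖ ≤ 1 → IsDiophantine γ₀ ωbar →
          ∀ V : (Fin d → ℝ) → ℝ, Continuous V → TorusPeriodic V →
          ∀ f : (Fin ν → ℝ) → (Fin d → ℝ) → ℝ → ℝ,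
            ContDiff ℝ 1 (fun p : (Fin ν → ℝ) × (Fin d → ℝ) × ℝ => f p.1 p.2.1 p.2.2) →
            (∀ x y, TorusPeriodic (fun φ => f φ x y)) →
            (∀ φ y, TorusPeriodic (fun x => f φ x y)) →
          ∀ u : (Fin ν → ℝ) → (Fin d → ℝ) → ℝ,
            Continuous (fun p : (Fin ν → ℝ) × (Fin d → ℝ) => u p.1 p.2) →
            (∀ x, TorusPeriodic (fun φ => u φ x)) →
            (∀ φ, TorusPeriodic (fun x => u φ x)) →
          ∀ ε lam : ℝ, lam ∈ Set.Icc (1 / 2 : ℝ) (3 / 2) →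
            IsGoodFamily c τ L₀ (fun θ => siteMatrix ωbar V f u ε lam θ) N →
            QuadraticNonresonance γ (fun a => lam * ωbar a) →
          ∀ θ : ℝ, ∃ P : Set (Set (Site ν d)),
            IsSeparatedPartition
              (badSites c Θ L₀ (siteMatrix ωbar V f u ε lam θ) N ((N : ℝ) ^ χ))
              ((N : ℝ) ^ C₁) ((N : ℝ) ^ 2) P := by
  classical
  -- The rank d + 1 is that of the ambient space, so the rank condition always holds; 3d + 2ν + 4 is
  -- the exponent of the fibre count.
  obtain ⟨b, hb⟩ := exists_chain_length_le d ν (3 * d + 2 * ν + 4) (d + 1)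
  -- At most N^b steps of length at most N² give diameter N^(b+2).
  refine ⟨((b + 2 : ℕ) : ℝ), by push_cast; linarith [(Nat.cast_nonneg b : (0 : ℝ) ≤ b)], ?_⟩
  intro γ₀ Θ γ τ χ hγ₀ _ _ hγ hχ hτ
  obtain ⟨N₁, hN₁⟩ := Filter.eventually_atTop.mp (eventually_lt_abs_of_isDiophantine ν hγ₀ hτ)
  -- The summands ensure, in order, the Diophantine separation, the chain bound, the fibre count, Θ
  -- ≤ N and 1 ≤ γN.
  refine ⟨N₁ + ((d + 1).factorial + 2 * ν + 5) + 2 * 3 ^ (d + ν) + ⌈Θ⌉₊ + ⌈γ⁻¹⌉₊, ?_⟩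
  intro N hN L₀ _ c _ _ _ _ _ ωbar hωbar hdioph V _ _ f _ _ _ u _ _ _ ε lam hlam hgood hNR θ
  have hΘN : Θ ≤ N := (Nat.le_ceil Θ).trans (by exact_mod_cast (by omega : ⌈Θ⌉₊ ≤ N))
  have hγN : 1 ≤ γ * N := by
    have : γ⁻¹ ≤ N := (Nat.le_ceil γ⁻¹).trans (by exact_mod_cast (by omega : ⌈γ⁻¹⌉₊ ≤ N))
    rwa [inv_le_iff_one_le_mul₀' hγ] at this
  have hω : ∀ a, |lam * ωbar a| ≤ 2 := by
    intro a
    have h1 : |ωbar a| ≤ 1 := (norm_le_pi_norm ωbar a).trans hωbar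
    rw [abs_mul, abs_of_pos (by linarith [hlam.1])]
    nlinarith [hlam.1, hlam.2, abs_nonneg (ωbar a)]
  refine exists_isSeparatedPartition _ fun z L hzS hinj hz => ?_
  have hL : L ≤ N ^ b := by
    refine hb N (by omega) γ Θ hγ hγN hΘN _ hω hNR θ z L hz ?_ ?_ ?_
    · intro p _ q _
      refine abs_waveForm_sub_le_of_norm_diag_lt ωbar V f u ε lam θ ?_ ?_
      · exact not_le.mp (not_or.mp (hzS p).1).1
      · exact not_le.mp (not_or.mp (hzS q).1).1
    · intro j
      rw [← Finset.card_image_of_injOn (f := z) (s := (Finset.range (L + 1)).filter _)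
        (hinj.mono fun q hq => by
          have := (Finset.mem_filter.mp (Finset.mem_coe.mp hq)).1
          exact Set.mem_Iic.mpr (Nat.lt_succ_iff.mp (Finset.mem_range.mp this)))]
      refine card_badSites_fiber_le c (Θ := Θ) (by omega) hχ ωbar V f u ε θ
        (hN₁ N (by omega) ωbar hdioph lam hlam) hgood j _ ?_
      intro i hi
      obtain ⟨q, hq, rfl⟩ := Finset.mem_image.mp hi
      exact ⟨hzS q, (Finset.mem_filter.mp hq).2⟩
    · rw [← finrank_prod_pi d]
      exact Submodule.finrank_le _
  have hL' : (L : ℝ) ≤ (N : ℝ) ^ b := by exact_mod_cast hL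
  refine (norm_sub_le_of_chain hz (Nat.zero_le L) le_rfl).trans ?_
  rw [Nat.sub_zero, Real.rpow_natCast, pow_add]
  gcongr

end
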